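/- For a positive integer $n$ let $\omega(n)$ be the number of distinct primes dividing $n$. For a positive integer $N$ let $\mathbb{P}_N$ denote probability with respect to $n$ chosen uniformly from the integers in $[1,N]$, and for $N\ge 3$ and real $A>0$ put $$T_N(A)=\mathbb{P}_N\left(\left|\frac{\omega(n)-\ln\ln N}{\sqrt{\ln\ln N}}\right|>A\right).$$ For even $r\ge 0$ and $A>0$ put $$B_r(A)=\frac{r!}{2^{r/2}\,(r/2)!\,A^r}.$$ Then: 1. For every even $r\ge 0$ and every $\varepsilon>0$ there is $N_0=N_0(r,\varepsilon)$ such that for all $N\ge N_0$ and all $A>0$, $$T_N(A)<(1+\varepsilon)\,B_r(A).$$ 2. For every $A>0$, if $r(A)$ denotes the largest even integer smaller than $1+A^2$, then $B_{r(A)}(A)\le B_r(A)$ for every even $r\ge 0$. 3. As $A\to\infty$, $B_{r(A)}(A)\sim\sqrt2\,\exp(-A^2/2)$. 4. There is $A_0$ such that for every $A\ge A_0$ there is $N_0=N_0(A)$ such that for all $N\ge N_0$, $$T_N(A)\le\sqrt2\,\exp\left(-\frac{A^2}{2}\right).$$ -/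

import Mathlib

open Filter Asymptotics

noncomputable section

/-- The standardised number of distinct prime factors of `n`, relative to the range `[1, N]`:
`(ω(n) - ln ln N) / √(ln ln N)`. -/
def normalizedOmega (N n : ℕ) : ℝ :=
  ((ArithmeticFunction.cardDistinctFactors n : ℝ) - Real.log (Real.log N)) /
    Real.sqrt (Real.log (Real.log N))

/-- The probability that `|(ω(n) - ln ln N) / √(ln ln N)| > A`, where `n` is uniformly distributed
on the integers in `[1, N]`. -/
def omegaTail (N : ℕ) (A : ℝ) : ℝ :=
  (ProbabilityTheory.uniformOn (Set.Icc 1 N)).real {n : ℕ | A < |normalizedOmega N n|}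

/-- The quantity `r! / (2^(r/2) (r/2)! A^r)`, used only for even `r`. -/
def momentBound (r : ℕ) (A : ℝ) : ℝ :=
  (r.factorial : ℝ) / (2 ^ (r / 2) * ((r / 2).factorial : ℝ) * A ^ r)

/-- The largest even natural number `r` with `r < 1 + A ^ 2`. -/
def optimalOrder (A : ℝ) : ℕ :=
  sSup {r : ℕ | Even r ∧ (r : ℝ) < 1 + A ^ 2}

/-- The supremum defining `optimalOrder` is always attained. -/
theorem optimalOrder_isGreatest (A : ℝ) :
    IsGreatest {r : ℕ | Even r ∧ (r : ℝ) < 1 + A ^ 2} (optimalOrder A) := by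
  have hne : {r : ℕ | Even r ∧ (r : ℝ) < 1 + A ^ 2}.Nonempty :=
    ⟨0, by simp, by push_cast; positivity⟩
  have hb : BddAbove {r : ℕ | Even r ∧ (r : ℝ) < 1 + A ^ 2} := by
    refine ⟨⌈1 + A ^ 2⌉₊, fun r hr => ?_⟩
    exact_mod_cast hr.2.le.trans (Nat.le_ceil _)
  exact ⟨Nat.sSup_mem hne hb, fun r hr => le_csSup hb hr⟩

end

/-!
The proof is by the method of moments. For `N → ∞` the even moments of `normalizedOmega N` over
`[1, N]` converge to the Gaussian moments `(2 k)! / (2 ^ k k!)`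
(`tendsto_uniformMean_normalizedOmega_pow`), which has three ingredients.

* Fix `s = 2 k + 1` and let `P` be the set of primes `p ≤ N ^ (1 / s)`. An integer `n ≤ N` has fewer
  than `s` prime factors outside `P`, and by Mertens' second theorem
  (`exists_abs_sum_inv_primesLE_sub_log_log_le`) the sum of `1 / p` over `P` is `log log N + O(1)`.
  So `ω(n) - log log N` differs by a bounded amount from the sum over `p ∈ P` of
  `1_{p ∣ n} - 1 / p`.
* A product of `j` primes divides `n` with probability `1 / d + O(1 / N)`, `d` being the product of
  the distinct ones among them. Hence the `2 k`-th moment of this sum differs by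
  `O(|P| ^ (2 k) / N) = O(1)` from that of a sum of independent centred Bernoulli variables of means
  `1 / p` (`abs_uniformMean_central_sub_le`).
* The moments of the independent sum are Gaussian to leading order in the variance
  (`exists_abs_bernoulliCentralMoment_sub_le`): adding one variable of variance `v` changes the
  `r`-th moment by `r (r - 1) / 2 * v` times the `(r - 2)`-nd moment and terms of lower order, and
  Gaussian moments obey the same recursion.

Chebyshev's inequality turns this into the tail bound with `momentBound r A`. The ratio of the
bounds of orders `2 k + 2` and `2 k` is `(2 k + 1) / A ^ 2`, which identifies the optimal order, and
Stirling's formula gives the size of the optimal bound.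

For the last claim the bounds `momentBound r A` do not suffice: when `A ^ 2` is close to an odd
integer, the best of them exceeds `√2 exp (-A ^ 2 / 2)` by a factor `1 + O(A⁻²)`. Chebyshev's
inequality is therefore applied to the polynomial `x ^ (2 k) (x ^ 2 - c) ^ 2` instead. With
`m = 2 k + 1`, `s = A ^ 2 - m` and the best choice `c = m - 2 m / s`, this multiplies the bound of
order `2 k` by `2 m / (2 m + s ^ 2)`. The bound of order `2 k` is at most
`√2 exp (-A ^ 2 / 2) exp ((s + 1) ^ 2 / (8 k))`, so for bounded large `s` the gain in the exponent is
about `s ^ 2 / (4 k)` and the loss about half as much (`gaussianMoment_div_pow_mul_lt`).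
-/

/-! ### Mertens' estimates -/

theorem log_factorial_eq_sum_primesLE (n : ℕ) :
    Real.log (n.factorial : ℝ) =
      ∑ p ∈ n.primesLE, (padicValNat p n.factorial : ℝ) * Real.log p := by
  rw [Real.log_nat_eq_sum_factorization, Finsupp.sum]
  refine Finset.sum_subset_zero_on_sdiff (fun p hp => ?_) (fun p hp => ?_) (fun p hp => ?_)
  · have h := Nat.mem_primeFactors.1 (Nat.support_factorization _ ▸ hp)
    exact Nat.mem_primesLE.2 ⟨(h.1.dvd_factorial).1 h.2.1, h.1⟩
  · have h := Finset.mem_sdiff.1 hp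
    rw [← Nat.factorization_def _ (Nat.prime_of_mem_primesLE h.1), Finsupp.notMem_support_iff.1 h.2]
    simp
  · rw [Nat.factorization_def]
    exact (Nat.mem_primeFactors.1 (Nat.support_factorization _ ▸ hp)).1

theorem div_le_padicValNat_factorial {p : ℕ} (hp : p.Prime) (n : ℕ) :
    n / p ≤ padicValNat p n.factorial := by
  have := Fact.mk hp
  rw [← padicValNat_mul_div_factorial, padicValNat_factorial_mul]
  omega

theorem padicValNat_factorial_le_div_sub_one {p : ℕ} (hp : p.Prime) (n : ℕ) :
    (padicValNat p n.factorial : ℝ) ≤ n / (p - 1) := by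
  have := Fact.mk hp
  have h1 : (1 : ℝ) < p := by exact_mod_cast hp.one_lt
  rw [le_div_iff₀ (by linarith)]
  have h := sub_one_mul_padicValNat_factorial (p := p) n
  have h2 : (p - 1) * padicValNat p n.factorial ≤ n := by omega
  have h3 : (((p - 1 : ℕ) : ℝ)) * padicValNat p n.factorial ≤ n := by exact_mod_cast h2
  rw [Nat.cast_sub hp.one_le] at h3
  push_cast at h3
  linarith

theorem log_factorial_le_mul_log (n : ℕ) : Real.log (n.factorial : ℝ) ≤ n * Real.log n := by
  rw [← Real.log_pow]
  exact Real.log_le_log (by exact_mod_cast n.factorial_pos) (by exact_mod_cast n.factorial_le_pow)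

theorem mul_log_sub_le_log_factorial (n : ℕ) :
    n * Real.log n - n ≤ Real.log (n.factorial : ℝ) := by
  rcases eq_or_ne n 0 with rfl | hn
  · simp
  have h := Stirling.le_log_factorial_stirling hn
  have h1 : 0 ≤ Real.log n := Real.log_natCast_nonneg n
  have h2 : 0 ≤ Real.log (2 * Real.pi) := Real.log_nonneg (by linarith [Real.pi_gt_three])
  linarith

/-- `∑ log p / (p (p - 1))` converges, because `log p ≤ 2 √p`. -/
theorem exists_sum_log_div_mul_sub_one_le :
    ∃ C : ℝ, ∀ n : ℕ, ∑ p ∈ n.primesLE, Real.log p / (p * (p - 1)) ≤ C := by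
  have hs : Summable fun n : ℕ => 4 * (1 / (n : ℝ) ^ (3 / 2 : ℝ)) :=
    (Real.summable_one_div_nat_rpow.2 (by norm_num)).mul_left 4
  refine ⟨∑' n : ℕ, 4 * (1 / (n : ℝ) ^ (3 / 2 : ℝ)), fun n => ?_⟩
  refine le_trans (Finset.sum_le_sum fun p hp => ?_)
    (hs.sum_le_tsum n.primesLE fun i _ => by positivity)
  have hp2 : (2 : ℝ) ≤ p := by exact_mod_cast Nat.two_le_of_mem_primesLE hp
  have hl : Real.log p ≤ 2 * (p : ℝ) ^ (1 / 2 : ℝ) := by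
    have := Real.log_le_rpow_div (x := p) (by linarith) (ε := 1 / 2) (by norm_num)
    linarith
  have hq : (p : ℝ) ^ (1 / 2 : ℝ) * (p : ℝ) ^ (3 / 2 : ℝ) = p ^ 2 := by
    rw [← Real.rpow_add (by linarith)]; norm_num
  have h32 : 0 < (p : ℝ) ^ (3 / 2 : ℝ) := by positivity
  rw [mul_one_div, div_le_div_iff₀ (by nlinarith) h32]
  nlinarith [mul_le_mul_of_nonneg_right hl h32.le]

/-- Mertens' first theorem. -/
theorem exists_abs_sum_log_div_sub_log_le :
    ∃ C : ℝ, ∀ n : ℕ, 1 ≤ n →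
      |∑ p ∈ n.primesLE, Real.log p / p - Real.log n| ≤ C := by
  obtain ⟨C, hC⟩ := exists_sum_log_div_mul_sub_one_le
  refine ⟨max (Real.log 4) (C + 1), fun n hn => ?_⟩
  have hn0 : (0 : ℝ) < n := by exact_mod_cast hn
  have hlog : ∀ p ∈ n.primesLE, 0 ≤ Real.log p := fun p _ => Real.log_natCast_nonneg p
  rw [abs_le]
  constructor
  · -- `log n! ≤ n ∑ log p / (p - 1)` bounds the sum from below
    have h1 : Real.log (n.factorial : ℝ) ≤
        n * (∑ p ∈ n.primesLE, Real.log p / p) +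
          n * ∑ p ∈ n.primesLE, Real.log p / (p * (p - 1)) := by
      rw [log_factorial_eq_sum_primesLE, ← mul_add, ← Finset.sum_add_distrib, Finset.mul_sum]
      refine Finset.sum_le_sum fun p hp => ?_
      have hp2 : (2 : ℝ) ≤ p := by exact_mod_cast Nat.two_le_of_mem_primesLE hp
      refine (mul_le_mul_of_nonneg_right
        (padicValNat_factorial_le_div_sub_one (Nat.prime_of_mem_primesLE hp) n)
        (hlog p hp)).trans_eq ?_
      have : (p : ℝ) - 1 ≠ 0 := by linarith
      field_simp
      ring
    have h2 := mul_log_sub_le_log_factorial n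
    have h3 := mul_le_mul_of_nonneg_left (hC n) hn0.le
    have h4 : n * (Real.log n - 1 - C) ≤ n * (∑ p ∈ n.primesLE, Real.log p / p) := by linarith
    have h5 := le_of_mul_le_mul_left h4 hn0
    linarith [le_max_right (Real.log 4) (C + 1)]
  · -- `log n! ≥ ∑ (n / p - 1) log p` and Chebyshev's bound for `θ n` bound it from above
    have h1 : n * (∑ p ∈ n.primesLE, Real.log p / p) - Chebyshev.theta n ≤
        Real.log (n.factorial : ℝ) := by
      rw [log_factorial_eq_sum_primesLE, Chebyshev.theta_eq_sum_primesLE_log, Finset.mul_sum,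
        ← Finset.sum_sub_distrib]
      refine Finset.sum_le_sum fun p hp => ?_
      have hp2 : (2 : ℝ) ≤ p := by exact_mod_cast Nat.two_le_of_mem_primesLE hp
      have h : (n : ℝ) / p - 1 ≤ padicValNat p n.factorial := by
        have h6 : ((n / p : ℕ) : ℝ) ≤ padicValNat p n.factorial := by
          exact_mod_cast div_le_padicValNat_factorial (Nat.prime_of_mem_primesLE hp) n
        have h7 := Nat.lt_floor_add_one ((n : ℝ) / p)
        rw [Nat.floor_div_eq_div] at h7
        linarith
      calc n * (Real.log p / p) - Real.log p = (n / p - 1) * Real.log p := by ring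
        _ ≤ _ := mul_le_mul_of_nonneg_right h (hlog p hp)
    have h2 := log_factorial_le_mul_log n
    have h3 := Chebyshev.theta_le_log4_mul_x hn0.le
    have h4 : n * (∑ p ∈ n.primesLE, Real.log p / p) ≤ n * (Real.log n + Real.log 4) := by
      linarith
    have h5 := le_of_mul_le_mul_left h4 hn0
    linarith [le_max_left (Real.log 4) (C + 1)]

/-- The difference between a step of `log log` and the corresponding step `log b - log a` weighted
by `1 / log b` is dominated by a telescoping quantity (here `a` and `b` stand for the logarithms of
consecutive integers). -/
theorem abs_sub_div_sub_log_sub_log_le {a b : ℝ} (ha : 0 < a) (hab : a ≤ b) (hb : b - a ≤ 1) :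
    |(b - a) / b - (Real.log b - Real.log a)| ≤ 1 / a - 1 / b := by
  have hb0 : 0 < b := ha.trans_le hab
  have h1 : Real.log b - Real.log a ≤ b / a - 1 := by
    rw [← Real.log_div hb0.ne' ha.ne']; exact Real.log_le_sub_one_of_pos (by positivity)
  have h2 : Real.log a - Real.log b ≤ a / b - 1 := by
    rw [← Real.log_div ha.ne' hb0.ne']; exact Real.log_le_sub_one_of_pos (by positivity)
  have h3 : (b - a) / b = 1 - a / b := by field_simp
  have h4 : b / a - 1 - (b - a) / b ≤ 1 / a - 1 / b := by
    have e1 : b / a - 1 - (b - a) / b = (b - a) * (1 / a - 1 / b) := by field_simp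
    have e2 : 0 ≤ 1 / a - 1 / b := sub_nonneg.2 (one_div_le_one_div_of_le ha hab)
    rw [e1]
    nlinarith
  rw [abs_le]
  constructor <;> linarith

/-- Mertens' second theorem, by partial summation from the first. -/
theorem exists_abs_sum_inv_primesLE_sub_log_log_le :
    ∃ C : ℝ, ∀ n : ℕ, 2 ≤ n →
      |∑ p ∈ n.primesLE, (p : ℝ)⁻¹ - Real.log (Real.log n)| ≤ C := by
  obtain ⟨C, hC⟩ := exists_abs_sum_log_div_sub_log_le
  set E : ℕ → ℝ := fun n => ∑ p ∈ n.primesLE, Real.log p / p - Real.log n with hE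
  set H : ℕ → ℝ := fun n => ∑ p ∈ n.primesLE, (p : ℝ)⁻¹ with hH
  set G : ℕ → ℝ := fun n => H n - E n / Real.log n - Real.log (Real.log n) with hG
  have hC0 : 0 ≤ C := (abs_nonneg _).trans (hC 1 le_rfl)
  have hpos : ∀ n : ℕ, 2 ≤ n → 0 < Real.log n := fun n hn =>
    Real.log_pos (by exact_mod_cast hn)
  have step : ∀ n : ℕ, 2 ≤ n →
      |G (n + 1) - G n| ≤ (C + 1) * (1 / Real.log n - 1 / Real.log (n + 1 : ℕ)) := by
    intro n hn
    have ha := hpos n hn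
    have hb := hpos (n + 1) (by omega)
    have hn0 : (0 : ℝ) < n := by positivity
    have hab : Real.log n ≤ Real.log (n + 1 : ℕ) :=
      Real.log_le_log hn0 (by push_cast; linarith)
    have hb1 : Real.log (n + 1 : ℕ) - Real.log n ≤ 1 := by
      rw [← Real.log_div (by positivity) hn0.ne']
      refine (Real.log_le_sub_one_of_pos (by positivity)).trans ?_
      have h1n : (1 : ℝ) ≤ n := by exact_mod_cast (by omega : 1 ≤ n)
      rw [sub_le_iff_le_add, div_le_iff₀ hn0]
      push_cast
      linarith
    have hmain := abs_sub_div_sub_log_sub_log_le ha hab hb1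
    have hHE : H (n + 1) - H n =
        (E (n + 1) - E n + (Real.log (n + 1 : ℕ) - Real.log n)) / Real.log (n + 1 : ℕ) := by
      simp only [hH, hE]
      rw [Nat.primesLE_succ]
      split_ifs with hp
      · rw [Finset.sum_insert (Nat.notMem_primesLE n), Finset.sum_insert (Nat.notMem_primesLE n)]
        field_simp
        ring
      · ring_nf
    have key : G (n + 1) - G n =
        ((Real.log (n + 1 : ℕ) - Real.log n) / Real.log (n + 1 : ℕ) -
          (Real.log (Real.log (n + 1 : ℕ)) - Real.log (Real.log n))) +
        E n * (1 / Real.log n - 1 / Real.log (n + 1 : ℕ)) := by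
      have : G (n + 1) - G n = (H (n + 1) - H n) - E (n + 1) / Real.log (n + 1 : ℕ)
          + E n / Real.log n - (Real.log (Real.log (n + 1 : ℕ)) - Real.log (Real.log n)) := by
        simp only [hG]; ring
      rw [this, hHE]
      ring
    have hd : 0 ≤ 1 / Real.log n - 1 / Real.log (n + 1 : ℕ) :=
      sub_nonneg.2 (one_div_le_one_div_of_le ha hab)
    have hEn := mul_le_mul_of_nonneg_right (hC n (by omega)) hd
    rw [key]
    refine (abs_add_le _ _).trans ?_
    rw [abs_mul, abs_of_nonneg hd]
    linarith
  have tele : ∀ n : ℕ, 2 ≤ n → |G n - G 2| ≤ (C + 1) * (1 / Real.log (2 : ℕ) - 1 / Real.log n) := by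
    intro n hn
    induction n, hn using Nat.le_induction with
    | base => simp
    | succ n hn ih =>
      have h := abs_add_le (G (n + 1) - G n) (G n - G 2)
      rw [sub_add_sub_cancel] at h
      linarith [step n hn]
  refine ⟨|G 2| + (C + 1) * (1 / Real.log (2 : ℕ)) + C / Real.log (2 : ℕ), fun n hn => ?_⟩
  have h2 := hpos 2 le_rfl
  have hln := hpos n hn
  have e1 : H n - Real.log (Real.log n) = (G n - G 2) + G 2 + E n / Real.log n := by
    simp only [hG]; ring
  have e2 : |E n / Real.log n| ≤ C / Real.log (2 : ℕ) := by
    rw [abs_div, abs_of_pos hln]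
    exact div_le_div₀ hC0 (hC n (by omega)) h2
      (Real.log_le_log (by norm_num) (by exact_mod_cast hn))
  have e3 : 0 ≤ (C + 1) * (1 / Real.log n) := by positivity
  change |H n - Real.log (Real.log n)| ≤ _
  rw [e1]
  have := abs_add_le (G n - G 2 + G 2) (E n / Real.log n)
  have := abs_add_le (G n - G 2) (G 2)
  linarith [tele n hn]

theorem exists_sum_inv_sq_primesLE_le :
    ∃ C : ℝ, ∀ n : ℕ, ∑ p ∈ n.primesLE, ((p : ℝ)⁻¹) ^ 2 ≤ C := by
  have hs : Summable fun n : ℕ => ((n : ℝ)⁻¹) ^ 2 := by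
    simp [inv_pow]
  exact ⟨_, fun n => hs.sum_le_tsum n.primesLE fun i _ => by positivity⟩

/-! ### Central moments of a sum of independent Bernoulli variables -/

section BernoulliModel

variable {ι : Type*}

/-- The variance of the number of elements of a random set
which contains each `i ∈ P` independently with probability `x i`. -/
def bernoulliVariance (x : ι → ℝ) (P : Finset ι) : ℝ :=
  ∑ i ∈ P, x i * (1 - x i)

theorem bernoulliVariance_nonneg {x : ι → ℝ} (hx : ∀ i, 0 ≤ x i ∧ x i ≤ 1) (P : Finset ι) :
    0 ≤ bernoulliVariance x P :=
  Finset.sum_nonneg fun i _ => mul_nonneg (hx i).1 (sub_nonneg.2 (hx i).2)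

variable [DecidableEq ι]

/-- The expectation of `f D`, where `D ⊆ P` is the random set that contains each `i ∈ P`
independently with probability `x i`. -/
noncomputable def bernoulliExpect (x : ι → ℝ) (P : Finset ι) (f : Finset ι → ℝ) : ℝ :=
  ∑ D ∈ P.powerset, ((∏ i ∈ D, x i) * ∏ i ∈ P \ D, (1 - x i)) * f D

/-- The `r`-th central moment of the number of elements of the random set of `bernoulliExpect`. -/
noncomputable def bernoulliCentralMoment (x : ι → ℝ) (r : ℕ) (P : Finset ι) : ℝ :=
  bernoulliExpect x P fun D => ((D.card : ℝ) - ∑ i ∈ P, x i) ^ r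

/-- The `2 k`-th moment `(2 k)! / (2 ^ k k!)` of a standard Gaussian variable. -/
noncomputable def gaussianMoment (k : ℕ) : ℝ :=
  ((2 * k).factorial : ℝ) / (2 ^ k * (k.factorial : ℝ))

theorem gaussianMoment_zero : gaussianMoment 0 = 1 := by simp [gaussianMoment]

theorem gaussianMoment_pos (k : ℕ) : 0 < gaussianMoment k := by
  unfold gaussianMoment; positivity

theorem gaussianMoment_succ (k : ℕ) :
    gaussianMoment (k + 1) = (2 * k + 1) * gaussianMoment k := by
  unfold gaussianMoment
  rw [show 2 * (k + 1) = 2 * k + 1 + 1 by ring, Nat.factorial_succ, Nat.factorial_succ,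
    Nat.factorial_succ]
  push_cast
  field_simp
  ring

theorem bernoulliExpect_insert (x : ι → ℝ) {P : Finset ι} {a : ι} (ha : a ∉ P)
    (f : Finset ι → ℝ) :
    bernoulliExpect x (insert a P) f =
      (1 - x a) * bernoulliExpect x P f + x a * bernoulliExpect x P fun D => f (insert a D) := by
  unfold bernoulliExpect
  rw [Finset.sum_powerset_insert ha, Finset.mul_sum, Finset.mul_sum]
  congr 1 <;> refine Finset.sum_congr rfl fun D hD => ?_ <;> rw [Finset.mem_powerset] at hD
  · have haD : a ∉ D := fun h => ha (hD h)
    rw [Finset.insert_sdiff_of_notMem _ haD,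
      Finset.prod_insert fun h => ha (Finset.mem_sdiff.1 h).1]
    ring
  · have haD : a ∉ D := fun h => ha (hD h)
    have : insert a P \ insert a D = P \ D := by
      rw [Finset.insert_sdiff_insert, Finset.sdiff_insert_of_notMem ha]
    rw [this, Finset.prod_insert haD]
    ring

theorem bernoulliExpect_const_one (x : ι → ℝ) (P : Finset ι) :
    bernoulliExpect x P (fun _ => 1) = 1 := by
  unfold bernoulliExpect
  simp_rw [mul_one]
  rw [← Finset.prod_add]
  simp

theorem bernoulliExpect_subset (x : ι → ℝ) {P Q : Finset ι} (hQ : Q ⊆ P) :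
    bernoulliExpect x P (fun D => if Q ⊆ D then 1 else 0) = ∏ i ∈ Q, x i := by
  have h : ∏ i ∈ P, (x i + if i ∈ Q then 0 else 1 - x i) = ∏ i ∈ Q, x i := by
    rw [← Finset.prod_subset hQ (fun i _ hi => by simp [hi])]
    exact Finset.prod_congr rfl fun i hi => by simp [hi]
  rw [← h, Finset.prod_add, bernoulliExpect]
  refine Finset.sum_congr rfl fun D hD => ?_
  rw [mul_assoc]
  congr 1
  split_ifs with hQD
  · rw [mul_one]
    refine Finset.prod_congr rfl fun i hi => ?_
    rw [if_neg fun h => (Finset.mem_sdiff.1 hi).2 (hQD h)]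
  · obtain ⟨i, hi, hiD⟩ := Finset.not_subset.1 hQD
    rw [mul_zero, eq_comm]
    exact Finset.prod_eq_zero (Finset.mem_sdiff.2 ⟨hQ hi, hiD⟩) (by simp [hi])

theorem bernoulliExpect_const_mul (x : ι → ℝ) (P : Finset ι) (c : ℝ) (f : Finset ι → ℝ) :
    bernoulliExpect x P (fun D => c * f D) = c * bernoulliExpect x P f := by
  simp only [bernoulliExpect, Finset.mul_sum]
  exact Finset.sum_congr rfl fun D _ => by ring

theorem bernoulliExpect_sum {κ : Type*} (x : ι → ℝ) (P : Finset ι) (s : Finset κ)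
    (f : κ → Finset ι → ℝ) :
    bernoulliExpect x P (fun D => ∑ j ∈ s, f j D) = ∑ j ∈ s, bernoulliExpect x P (f j) := by
  simp only [bernoulliExpect, Finset.mul_sum]
  exact Finset.sum_comm

/-- The `j`-th central moment of a Bernoulli variable with mean `t`. -/
def bernoulliOneMoment (j : ℕ) (t : ℝ) : ℝ :=
  (1 - t) * (-t) ^ j + t * (1 - t) ^ j

theorem abs_bernoulliOneMoment_le {t : ℝ} (h0 : 0 ≤ t) (h1 : t ≤ 1) (j : ℕ) :
    |bernoulliOneMoment (j + 2) t| ≤ t * (1 - t) := by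
  have e : bernoulliOneMoment (j + 2) t =
      t * (1 - t) * (t * (-t) ^ j + (1 - t) * (1 - t) ^ j) := by
    unfold bernoulliOneMoment; ring
  have hv : 0 ≤ t * (1 - t) := mul_nonneg h0 (by linarith)
  have ha : |t * (-t) ^ j| ≤ t := by
    rw [abs_mul, abs_pow, abs_neg, abs_of_nonneg h0]
    exact mul_le_of_le_one_right h0 (pow_le_one₀ h0 h1)
  have hb : |(1 - t) * (1 - t) ^ j| ≤ 1 - t := by
    rw [abs_mul, abs_pow, abs_of_nonneg (sub_nonneg.2 h1)]
    exact mul_le_of_le_one_right (by linarith) (pow_le_one₀ (by linarith) (by linarith))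
  rw [e, abs_mul, abs_of_nonneg hv]
  refine mul_le_of_le_one_right hv ((abs_add_le _ _).trans ?_)
  linarith

theorem bernoulliCentralMoment_insert (x : ι → ℝ) (r : ℕ) {P : Finset ι} {a : ι} (ha : a ∉ P) :
    bernoulliCentralMoment x r (insert a P) =
      ∑ j ∈ Finset.range (r + 1), (r.choose j : ℝ) * bernoulliOneMoment j (x a) *
        bernoulliCentralMoment x (r - j) P := by
  unfold bernoulliCentralMoment
  rw [bernoulliExpect_insert x ha, Finset.sum_insert ha]
  have e0 : (fun D : Finset ι => ((D.card : ℝ) - (x a + ∑ i ∈ P, x i)) ^ r) = fun D =>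
      ∑ j ∈ Finset.range (r + 1), ((r.choose j : ℝ) * (-x a) ^ j) *
        ((D.card : ℝ) - ∑ i ∈ P, x i) ^ (r - j) := by
    funext D
    rw [show (D.card : ℝ) - (x a + ∑ i ∈ P, x i) = -x a + (D.card - ∑ i ∈ P, x i) by ring,
      add_pow]
    exact Finset.sum_congr rfl fun j _ => by ring
  have e1 : bernoulliExpect x P
        (fun D => (((insert a D).card : ℝ) - (x a + ∑ i ∈ P, x i)) ^ r) =
      bernoulliExpect x P fun D =>
        ∑ j ∈ Finset.range (r + 1), ((r.choose j : ℝ) * (1 - x a) ^ j) *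
          ((D.card : ℝ) - ∑ i ∈ P, x i) ^ (r - j) := by
    refine Finset.sum_congr rfl fun D hD => ?_
    have haD : a ∉ D := fun h => ha (Finset.mem_powerset.1 hD h)
    congr 1
    dsimp only
    rw [Finset.card_insert_of_notMem haD, Nat.cast_add_one,
      show (D.card : ℝ) + 1 - (x a + ∑ i ∈ P, x i) = (1 - x a) + (D.card - ∑ i ∈ P, x i) by ring,
      add_pow]
    exact Finset.sum_congr rfl fun j _ => by ring
  rw [e0, e1]
  simp only [bernoulliExpect_sum, bernoulliExpect_const_mul, Finset.mul_sum]
  rw [← Finset.sum_add_distrib]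
  refine Finset.sum_congr rfl fun j _ => ?_
  unfold bernoulliOneMoment
  ring

theorem bernoulliCentralMoment_zero (x : ι → ℝ) (P : Finset ι) :
    bernoulliCentralMoment x 0 P = 1 := by
  simp [bernoulliCentralMoment, bernoulliExpect_const_one]

theorem bernoulliCentralMoment_empty (x : ι → ℝ) (r : ℕ) :
    bernoulliCentralMoment x r ∅ = 0 ^ r := by
  simp [bernoulliCentralMoment, bernoulliExpect]

theorem bernoulliCentralMoment_one (x : ι → ℝ) (P : Finset ι) :
    bernoulliCentralMoment x 1 P = 0 := by
  induction P using Finset.induction_on with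
  | empty => simp [bernoulliCentralMoment_empty]
  | insert a P ha ih =>
    rw [bernoulliCentralMoment_insert x 1 ha]
    simp only [Finset.sum_range_succ, Finset.sum_range_zero]
    simp [ih, bernoulliOneMoment]
    left
    ring

/-- Splitting off one variable changes the `(n + 2)`-nd central moment by the second-order term
and terms of higher order; there is no first-order term because the variable is centred. -/
theorem bernoulliCentralMoment_insert_add_two (x : ι → ℝ) (n : ℕ) {P : Finset ι} {a : ι}
    (ha : a ∉ P) :
    bernoulliCentralMoment x (n + 2) (insert a P) =
      bernoulliCentralMoment x (n + 2) P +
        ((n + 2).choose 2 : ℝ) * (x a * (1 - x a)) * bernoulliCentralMoment x n P +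
        ∑ j ∈ Finset.range n, ((n + 2).choose (j + 3) : ℝ) * bernoulliOneMoment (j + 3) (x a) *
          bernoulliCentralMoment x (n - 1 - j) P := by
  rw [bernoulliCentralMoment_insert x _ ha, Finset.sum_range_succ', Finset.sum_range_succ',
    Finset.sum_range_succ']
  have e : ∀ j, n + 2 - (j + 1 + 1 + 1) = n - 1 - j := fun j => by omega
  simp only [e]
  have h0 : bernoulliOneMoment 0 (x a) = 1 := by unfold bernoulliOneMoment; ring
  have h1 : bernoulliOneMoment 1 (x a) = 0 := by unfold bernoulliOneMoment; ring
  have h2 : bernoulliOneMoment 2 (x a) = x a * (1 - x a) := by unfold bernoulliOneMoment; ring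
  simp only [Nat.zero_add, Nat.reduceAdd, h0, h1, h2, Nat.choose_zero_right, Nat.add_sub_cancel,
    Nat.sub_zero]
  push_cast
  ring

theorem bernoulliVariance_insert (x : ι → ℝ) {P : Finset ι} {a : ι} (ha : a ∉ P) :
    bernoulliVariance x (insert a P) = bernoulliVariance x P + x a * (1 - x a) := by
  rw [bernoulliVariance, Finset.sum_insert ha, add_comm]; rfl

theorem bernoulliCentralMoment_two (x : ι → ℝ) (P : Finset ι) :
    bernoulliCentralMoment x 2 P = bernoulliVariance x P := by
  induction P using Finset.induction_on with
  | empty => simp [bernoulliCentralMoment_empty, bernoulliVariance]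
  | insert a P ha ih =>
    have h := bernoulliCentralMoment_insert_add_two x 0 ha
    simp only [Nat.zero_add] at h
    rw [h, ih, bernoulliVariance_insert x ha, bernoulliCentralMoment_zero]
    simp

/-- The `r`-th moment of a centred Gaussian variable of variance `V`. -/
noncomputable def gaussianMomentVar (r : ℕ) (V : ℝ) : ℝ :=
  if Even r then gaussianMoment (r / 2) * V ^ (r / 2) else 0

/-- The first-order Taylor expansion of `V ^ k`; multiplying by `(1 + V) ^ 2` avoids a negative
exponent on the right. -/
theorem exists_abs_add_pow_sub_le (k : ℕ) :
    ∃ C : ℝ, 0 ≤ C ∧ ∀ V v : ℝ, 0 ≤ V → 0 ≤ v → v ≤ 1 →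
      |(V + v) ^ k - V ^ k - k * v * V ^ (k - 1)| * (1 + V) ^ 2 ≤ C * v * (1 + V) ^ k := by
  induction k with
  | zero => exact ⟨0, le_rfl, fun V v _ _ _ => by simp⟩
  | succ k ih =>
    obtain ⟨C, hC0, hC⟩ := ih
    refine ⟨C + k, by positivity, fun V v hV hv hv1 => ?_⟩
    have hVk : (k : ℝ) * V ^ k = k * (V * V ^ (k - 1)) := by
      rcases k with _ | k
      · simp
      · rw [Nat.add_sub_cancel, pow_succ']
    have e : (V + v) ^ (k + 1) - V ^ (k + 1) - ((k + 1 : ℕ) : ℝ) * v * V ^ (k + 1 - 1) =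
        (V + v) * ((V + v) ^ k - V ^ k - k * v * V ^ (k - 1)) + v * (k * v * V ^ (k - 1)) := by
      rw [Nat.add_sub_cancel]
      push_cast
      linear_combination (-v) * hVk
    have h1 : (k : ℝ) * v * V ^ (k - 1) * (1 + V) ^ 2 ≤ k * (1 + V) ^ (k + 1) := by
      rcases k with _ | k
      · simp
      · rw [Nat.add_sub_cancel, show k + 1 + 1 = k + 2 by ring, pow_add, ← mul_assoc]
        gcongr
        · calc ((k + 1 : ℕ) : ℝ) * v ≤ ((k + 1 : ℕ) : ℝ) * 1 := by gcongr
            _ = _ := mul_one _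
        · linarith
    have h2 := hC V v hV hv hv1
    rw [e]
    have h3 : 0 ≤ V + v := by positivity
    have h4 : 0 ≤ v * (k * v * V ^ (k - 1)) := by positivity
    calc |(V + v) * ((V + v) ^ k - V ^ k - k * v * V ^ (k - 1)) + v * (k * v * V ^ (k - 1))| *
          (1 + V) ^ 2
        ≤ ((V + v) * |(V + v) ^ k - V ^ k - k * v * V ^ (k - 1)| + v * (k * v * V ^ (k - 1))) *
          (1 + V) ^ 2 := by
          gcongr
          refine (abs_add_le _ _).trans ?_
          rw [abs_mul, abs_of_nonneg h3, abs_of_nonneg h4]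
      _ = (V + v) * (|(V + v) ^ k - V ^ k - k * v * V ^ (k - 1)| * (1 + V) ^ 2) +
          v * (k * v * V ^ (k - 1) * (1 + V) ^ 2) := by ring
      _ ≤ (1 + V) * (C * v * (1 + V) ^ k) + v * (k * (1 + V) ^ (k + 1)) :=
          add_le_add (mul_le_mul (by linarith) h2 (by positivity) (by positivity))
            (mul_le_mul_of_nonneg_left h1 hv)
      _ = (C + k) * v * (1 + V) ^ (k + 1) := by ring

/-- The Gaussian moments satisfy the recursion of `bernoulliCentralMoment_insert_add_two` up to
terms of lower order. -/
theorem exists_abs_gaussianMomentVar_sub_le (n : ℕ) :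
    ∃ C : ℝ, 0 ≤ C ∧ ∀ V v : ℝ, 0 ≤ V → 0 ≤ v → v ≤ 1 →
      |gaussianMomentVar (n + 2) (V + v) - gaussianMomentVar (n + 2) V -
        ((n + 2).choose 2 : ℝ) * v * gaussianMomentVar n V| * (1 + V) ^ 2 ≤
          C * v * (1 + V) ^ (n / 2 + 1) := by
  obtain ⟨C, hC0, hC⟩ := exists_abs_add_pow_sub_le (n / 2 + 1)
  refine ⟨gaussianMoment (n / 2 + 1) * C, mul_nonneg (gaussianMoment_pos _).le hC0,
    fun V v hV hv hv1 => ?_⟩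
  by_cases hn : Even n
  · have hn2 : Even (n + 2) := by simpa [Nat.even_add] using hn
    obtain ⟨k, rfl⟩ := hn
    have ek : (k + k) / 2 = k := by omega
    have ek2 : (k + k + 2) / 2 = k + 1 := by omega
    have hc : ((k + k + 2).choose 2 : ℝ) = (k + 1) * (2 * k + 1) := by
      rw [Nat.cast_choose_two]; push_cast; ring
    have h := hC V v hV hv hv1
    simp only [gaussianMomentVar, if_pos hn2, Even.add_self, if_true, ek, ek2] at h ⊢
    rw [Nat.add_sub_cancel] at h
    have e : gaussianMoment (k + 1) * (V + v) ^ (k + 1) - gaussianMoment (k + 1) * V ^ (k + 1) -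
        ((k + k + 2).choose 2 : ℝ) * v * (gaussianMoment k * V ^ k) =
        gaussianMoment (k + 1) *
          ((V + v) ^ (k + 1) - V ^ (k + 1) - ((k + 1 : ℕ) : ℝ) * v * V ^ k) := by
      rw [hc, gaussianMoment_succ]; push_cast; ring
    rw [e, abs_mul, abs_of_pos (gaussianMoment_pos _)]
    linarith [mul_le_mul_of_nonneg_left h (gaussianMoment_pos (k + 1)).le]
  · have hn2 : ¬ Even (n + 2) := by simpa [Nat.even_add] using hn
    simp only [gaussianMomentVar, if_neg hn, if_neg hn2]
    have := (gaussianMoment_pos (n / 2 + 1)).le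
    simp only [sub_zero, mul_zero, abs_zero, zero_mul]
    positivity

/-- The central moments are Gaussian to leading order. The proof is by induction on the order, and
for each order by adding the variables one at a time. -/
theorem exists_abs_bernoulliCentralMoment_sub_le {x : ι → ℝ} (hx : ∀ i, 0 ≤ x i ∧ x i ≤ 1)
    (r : ℕ) :
    ∃ C : ℝ, 0 ≤ C ∧ ∀ P : Finset ι,
      |bernoulliCentralMoment x r P - gaussianMomentVar r (bernoulliVariance x P)| *
        (1 + bernoulliVariance x P) ≤ C * (1 + bernoulliVariance x P) ^ ((r + 1) / 2) := by
  induction r using Nat.strong_induction_on with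
  | _ r ih =>
  rcases r with _ | _ | _ | n
  · exact ⟨0, le_rfl, fun P => by
      simp [bernoulliCentralMoment_zero, gaussianMomentVar, gaussianMoment_zero]⟩
  · exact ⟨0, le_rfl, fun P => by simp [bernoulliCentralMoment_one, gaussianMomentVar]⟩
  · exact ⟨0, le_rfl, fun P => by
      simp [bernoulliCentralMoment_two, gaussianMomentVar, gaussianMoment_succ 0,
        gaussianMoment_zero]⟩
  have hV : ∀ P, 0 ≤ bernoulliVariance x P := bernoulliVariance_nonneg hx
  -- a crude bound for all lower moments
  have crude : ∀ m, m < n + 3 → ∃ K : ℝ, 0 ≤ K ∧ ∀ P : Finset ι,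
      |bernoulliCentralMoment x m P| ≤ K * (1 + bernoulliVariance x P) ^ (m / 2) := by
    intro m hm
    obtain ⟨C, hC0, hC⟩ := ih m hm
    refine ⟨C + gaussianMoment (m / 2), add_nonneg hC0 (gaussianMoment_pos _).le, fun P => ?_⟩
    have h1 : 0 < 1 + bernoulliVariance x P := by linarith [hV P]
    have h2 : |bernoulliCentralMoment x m P - gaussianMomentVar m (bernoulliVariance x P)| ≤
        C * (1 + bernoulliVariance x P) ^ (m / 2) := by
      refine le_of_mul_le_mul_right ((hC P).trans ?_) h1
      rw [mul_assoc, ← pow_succ]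
      gcongr
      · linarith [hV P]
      · omega
    have h3 : |gaussianMomentVar m (bernoulliVariance x P)| ≤
        gaussianMoment (m / 2) * (1 + bernoulliVariance x P) ^ (m / 2) := by
      have := gaussianMoment_pos (m / 2)
      have hVP := hV P
      unfold gaussianMomentVar
      split_ifs
      · rw [abs_of_nonneg (by positivity)]
        gcongr
        linarith
      · rw [abs_zero]; positivity
    have h4 := abs_add_le
      (bernoulliCentralMoment x m P - gaussianMomentVar m (bernoulliVariance x P))
      (gaussianMomentVar m (bernoulliVariance x P))
    rw [sub_add_cancel] at h4
    linarith
  have hK : ∀ j : ℕ, ∃ K : ℝ, 0 ≤ K ∧ ∀ P : Finset ι,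
      |bernoulliCentralMoment x (n - j) P| ≤ K * (1 + bernoulliVariance x P) ^ (n / 2) := by
    intro j
    obtain ⟨K, hK0, hK⟩ := crude (n - j) (by omega)
    refine ⟨K, hK0, fun P => (hK P).trans ?_⟩
    gcongr
    · linarith [hV P]
    · omega
  choose K hK0 hK using hK
  obtain ⟨C₁, hC₁0, hC₁⟩ := ih (n + 1) (by omega)
  obtain ⟨C₂, hC₂0, hC₂⟩ := exists_abs_gaussianMomentVar_sub_le (n + 1)
  set S : ℝ := ∑ j ∈ Finset.range (n + 1), ((n + 3).choose (j + 3) : ℝ) * K j with hS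
  set B : ℝ := ((n + 3).choose 2 : ℝ) * C₁ + C₂ + S with hB
  have hS0 : 0 ≤ S := Finset.sum_nonneg fun j _ => mul_nonneg (by positivity) (hK0 j)
  have hB0 : 0 ≤ B := by positivity
  -- the increments of the error are summed over the variables
  have main : ∀ P : Finset ι,
      |bernoulliCentralMoment x (n + 3) P - gaussianMomentVar (n + 3) (bernoulliVariance x P)| ≤
        B * bernoulliVariance x P * (1 + bernoulliVariance x P) ^ (n / 2) := by
    intro P
    induction P using Finset.induction_on with
    | empty =>
      simp only [bernoulliCentralMoment_empty, bernoulliVariance, Finset.sum_empty,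
        gaussianMomentVar]
      have : (n + 3) / 2 ≠ 0 := by omega
      simp [this]
    | insert a P ha ihP =>
      rw [bernoulliVariance_insert x ha, bernoulliCentralMoment_insert_add_two x (n + 1) ha]
      have hVP := hV P
      have hv0 : 0 ≤ x a * (1 - x a) := mul_nonneg (hx a).1 (sub_nonneg.2 (hx a).2)
      have hv1 : x a * (1 - x a) ≤ 1 := mul_le_one₀ (hx a).2 (sub_nonneg.2 (hx a).2)
        (by linarith [(hx a).1])
      set V := bernoulliVariance x P
      set v := x a * (1 - x a)
      have hV1 : 0 < 1 + V := by linarith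
      have t1 : |bernoulliCentralMoment x (n + 1) P - gaussianMomentVar (n + 1) V| ≤
          C₁ * (1 + V) ^ (n / 2) := by
        refine le_of_mul_le_mul_right ((hC₁ P).trans_eq ?_) hV1
        rw [mul_assoc, ← pow_succ]
        congr 2
        omega
      have t2 : |gaussianMomentVar (n + 3) (V + v) - gaussianMomentVar (n + 3) V -
          ((n + 3).choose 2 : ℝ) * v * gaussianMomentVar (n + 1) V| ≤
          C₂ * v * (1 + V) ^ (n / 2) := by
        refine le_of_mul_le_mul_right ((hC₂ V v hVP hv0 hv1).trans ?_) (pow_pos hV1 2)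
        rw [mul_assoc (C₂ * v), ← pow_add]
        exact mul_le_mul_of_nonneg_left (pow_le_pow_right₀ (by linarith) (by omega))
          (mul_nonneg hC₂0 hv0)
      have t3 : |∑ j ∈ Finset.range (n + 1), ((n + 3).choose (j + 3) : ℝ) *
          bernoulliOneMoment (j + 3) (x a) * bernoulliCentralMoment x (n + 1 - 1 - j) P| ≤
          S * v * (1 + V) ^ (n / 2) := by
        refine (Finset.abs_sum_le_sum_abs _ _).trans ?_
        rw [hS, Finset.sum_mul, Finset.sum_mul]
        refine Finset.sum_le_sum fun j _ => ?_
        rw [abs_mul, abs_mul, Nat.abs_cast, Nat.add_sub_cancel]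
        calc ((n + 3).choose (j + 3) : ℝ) * |bernoulliOneMoment (j + 3) (x a)| *
              |bernoulliCentralMoment x (n - j) P|
            ≤ ((n + 3).choose (j + 3) : ℝ) * v * (K j * (1 + V) ^ (n / 2)) := by
              gcongr
              · exact abs_bernoulliOneMoment_le (hx a).1 (hx a).2 (j + 1)
              · exact hK j P
          _ = _ := by ring
      have e : bernoulliCentralMoment x (n + 1 + 2) P +
            ((n + 1 + 2).choose 2 : ℝ) * v * bernoulliCentralMoment x (n + 1) P +
            (∑ j ∈ Finset.range (n + 1), ((n + 1 + 2).choose (j + 3) : ℝ) *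
              bernoulliOneMoment (j + 3) (x a) * bernoulliCentralMoment x (n + 1 - 1 - j) P) -
            gaussianMomentVar (n + 3) (V + v) =
          (bernoulliCentralMoment x (n + 3) P - gaussianMomentVar (n + 3) V) +
          ((n + 3).choose 2 : ℝ) * v *
            (bernoulliCentralMoment x (n + 1) P - gaussianMomentVar (n + 1) V) -
          (gaussianMomentVar (n + 3) (V + v) - gaussianMomentVar (n + 3) V -
            ((n + 3).choose 2 : ℝ) * v * gaussianMomentVar (n + 1) V) +
          ∑ j ∈ Finset.range (n + 1), ((n + 3).choose (j + 3) : ℝ) *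
            bernoulliOneMoment (j + 3) (x a) * bernoulliCentralMoment x (n + 1 - 1 - j) P := by
        ring
      rw [e]
      have t1' : |((n + 3).choose 2 : ℝ) * v *
          (bernoulliCentralMoment x (n + 1) P - gaussianMomentVar (n + 1) V)| ≤
          ((n + 3).choose 2 : ℝ) * v * (C₁ * (1 + V) ^ (n / 2)) := by
        have hcv : 0 ≤ ((n + 3).choose 2 : ℝ) * v := by positivity
        rw [abs_mul, abs_of_nonneg hcv]
        gcongr
      refine (abs_add_le _ _).trans ((add_le_add ((abs_sub _ _).trans
        (add_le_add ((abs_add_le _ _).trans (add_le_add ihP t1')) t2)) t3).trans ?_)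
      calc B * V * (1 + V) ^ (n / 2) + ((n + 3).choose 2 : ℝ) * v * (C₁ * (1 + V) ^ (n / 2)) +
            C₂ * v * (1 + V) ^ (n / 2) + S * v * (1 + V) ^ (n / 2)
          = B * (V + v) * (1 + V) ^ (n / 2) := by rw [hB]; ring
        _ ≤ B * (V + v) * (1 + (V + v)) ^ (n / 2) := by
          gcongr
          linarith
  refine ⟨B, hB0, fun P => ?_⟩
  have hVP := hV P
  have : (n + 2 + 1 + 1) / 2 = n / 2 + 1 + 1 := by omega
  rw [this, pow_succ, pow_succ]
  calc _ ≤ B * bernoulliVariance x P * (1 + bernoulliVariance x P) ^ (n / 2) *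
        (1 + bernoulliVariance x P) := by
        gcongr
        exact main P
    _ ≤ B * (1 + bernoulliVariance x P) * (1 + bernoulliVariance x P) ^ (n / 2) *
        (1 + bernoulliVariance x P) := by
        gcongr
        linarith
    _ = _ := by ring

end BernoulliModel

/-! ### Divisibility by primes compared with the independent model -/

/-- The mean of `f` over the integers in `[1, N]`. -/
noncomputable def uniformMean (N : ℕ) (f : ℕ → ℝ) : ℝ :=
  (∑ n ∈ Finset.Icc 1 N, f n) / N

theorem uniformMean_add (N : ℕ) (f g : ℕ → ℝ) :
    uniformMean N (fun n => f n + g n) = uniformMean N f + uniformMean N g := by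
  simp [uniformMean, Finset.sum_add_distrib, add_div]

theorem uniformMean_const_mul (N : ℕ) (c : ℝ) (f : ℕ → ℝ) :
    uniformMean N (fun n => c * f n) = c * uniformMean N f := by
  simp [uniformMean, ← Finset.mul_sum, mul_div_assoc]

theorem uniformMean_sum {κ : Type*} (N : ℕ) (s : Finset κ) (f : κ → ℕ → ℝ) :
    uniformMean N (fun n => ∑ j ∈ s, f j n) = ∑ j ∈ s, uniformMean N (f j) := by
  simp only [uniformMean, Finset.sum_div]
  exact Finset.sum_comm

theorem uniformMean_const {N : ℕ} (hN : N ≠ 0) (c : ℝ) : uniformMean N (fun _ => c) = c := by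
  have : (N : ℝ) ≠ 0 := by exact_mod_cast hN
  simp [uniformMean, this]

theorem uniformMean_mono {N : ℕ} {f g : ℕ → ℝ} (h : ∀ n ∈ Finset.Icc 1 N, f n ≤ g n) :
    uniformMean N f ≤ uniformMean N g :=
  div_le_div_of_nonneg_right (Finset.sum_le_sum h) N.cast_nonneg

theorem abs_uniformMean_sub_le {N : ℕ} {f g h : ℕ → ℝ}
    (H : ∀ n ∈ Finset.Icc 1 N, |f n - g n| ≤ h n) :
    |uniformMean N f - uniformMean N g| ≤ uniformMean N h := by
  unfold uniformMean
  rw [← sub_div, ← Finset.sum_sub_distrib, abs_div, Nat.abs_cast]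
  exact div_le_div_of_nonneg_right
    ((Finset.abs_sum_le_sum_abs _ _).trans (Finset.sum_le_sum H)) N.cast_nonneg

theorem abs_uniformMean_dvd_sub_inv_le {N : ℕ} (hN : N ≠ 0) (d : ℕ) :
    |uniformMean N (fun n => if d ∣ n then 1 else 0) - (d : ℝ)⁻¹| ≤ 1 / N := by
  have hN0 : (0 : ℝ) < N := by exact_mod_cast Nat.pos_of_ne_zero hN
  have hc : ∑ n ∈ Finset.Icc 1 N, (if d ∣ n then (1 : ℝ) else 0) = (N / d : ℕ) := by
    rw [Finset.sum_boole, ← Nat.Ioc_filter_dvd_card_eq_div]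
    rfl
  rw [uniformMean, hc]
  have h1 := Nat.lt_floor_add_one ((N : ℝ) / d)
  have h2 := Nat.floor_le (show (0 : ℝ) ≤ (N : ℝ) / d by positivity)
  rw [Nat.floor_div_eq_div] at h1 h2
  have e : ((N / d : ℕ) : ℝ) / N - (d : ℝ)⁻¹ = (((N / d : ℕ) : ℝ) - N / d) / N := by
    field_simp
  rw [e, abs_div, Nat.abs_cast]
  gcongr
  rw [abs_le]
  constructor <;> linarith

/-- Inserting the condition `p ∈ D` for all `p ∈ P` in turn multiplies by the number of elements
of `D`. -/
theorem sum_ite_insert_subset {P D Q : Finset ℕ} (hD : D ⊆ P) (c : ℝ) :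
    ∑ p ∈ P, (if insert p Q ⊆ D then c else 0) = if Q ⊆ D then D.card * c else 0 := by
  by_cases hQ : Q ⊆ D
  · simp only [Finset.insert_subset_iff, hQ, and_true, if_true]
    rw [← Finset.sum_filter, Finset.filter_mem_eq_inter, Finset.inter_eq_right.2 hD]
    simp
  · simp [Finset.insert_subset_iff, hQ]

theorem subset_filter_dvd_iff_prod_dvd {P Q : Finset ℕ} (hP : ∀ p ∈ P, p.Prime) (hQ : Q ⊆ P)
    (n : ℕ) : Q ⊆ P.filter (· ∣ n) ↔ (∏ p ∈ Q, p) ∣ n := by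
  constructor
  · intro h
    exact Finset.prod_primes_dvd n (fun p hp => (hP p (hQ hp)).prime)
      fun p hp => (Finset.mem_filter.1 (h hp)).2
  · intro h p hp
    exact Finset.mem_filter.2 ⟨hQ hp, (Finset.dvd_prod_of_mem (fun i => i) hp).trans h⟩

/-- The raw moments of the number of prime divisors in `P` are those of the independent model, up
to an error of at most `|P| ^ j / N`. The restriction to `Q ⊆ D` is there for the induction. -/
theorem abs_uniformMean_card_pow_sub_le {P : Finset ℕ} (hP : ∀ p ∈ P, p.Prime) {N : ℕ}
    (hN : N ≠ 0) (j : ℕ) :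
    ∀ Q ⊆ P,
    |uniformMean N (fun n => if Q ⊆ P.filter (· ∣ n) then ((P.filter (· ∣ n)).card : ℝ) ^ j else 0)
      - bernoulliExpect (fun p : ℕ => (p : ℝ)⁻¹) P
        (fun D => if Q ⊆ D then (D.card : ℝ) ^ j else 0)| ≤ (P.card : ℝ) ^ j / N := by
  induction j with
  | zero =>
    intro Q hQ
    simp only [pow_zero]
    rw [bernoulliExpect_subset _ hQ]
    simp only [subset_filter_dvd_iff_prod_dvd hP hQ]
    rw [Finset.prod_inv_distrib, ← Nat.cast_prod]
    exact abs_uniformMean_dvd_sub_inv_le hN _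
  | succ j ih =>
    intro Q hQ
    have e1 : uniformMean N (fun n => if Q ⊆ P.filter (· ∣ n) then
        ((P.filter (· ∣ n)).card : ℝ) ^ (j + 1) else 0) =
        ∑ p ∈ P, uniformMean N (fun n => if insert p Q ⊆ P.filter (· ∣ n) then
          ((P.filter (· ∣ n)).card : ℝ) ^ j else 0) := by
      rw [← uniformMean_sum]
      simp only [sum_ite_insert_subset (Finset.filter_subset _ _), pow_succ']
    have e2 : bernoulliExpect (fun p : ℕ => (p : ℝ)⁻¹) P
        (fun D => if Q ⊆ D then (D.card : ℝ) ^ (j + 1) else 0) =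
        ∑ p ∈ P, bernoulliExpect (fun p : ℕ => (p : ℝ)⁻¹) P
          (fun D => if insert p Q ⊆ D then (D.card : ℝ) ^ j else 0) := by
      rw [← bernoulliExpect_sum]
      refine Finset.sum_congr rfl fun D hD => ?_
      simp only [sum_ite_insert_subset (Finset.mem_powerset.1 hD), pow_succ']
    rw [e1, e2, ← Finset.sum_sub_distrib]
    refine (Finset.abs_sum_le_sum_abs _ _).trans
      ((Finset.sum_le_sum fun p hp => ih _ (Finset.insert_subset hp hQ)).trans_eq ?_)
    rw [Finset.sum_const, nsmul_eq_mul, pow_succ']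
    ring

theorem abs_uniformMean_central_sub_le {P : Finset ℕ} (hP : ∀ p ∈ P, p.Prime) {N : ℕ}
    (hN : N ≠ 0) (r : ℕ) :
    |uniformMean N (fun n => (((P.filter (· ∣ n)).card : ℝ) - ∑ p ∈ P, (p : ℝ)⁻¹) ^ r)
      - bernoulliCentralMoment (fun p : ℕ => (p : ℝ)⁻¹) r P| ≤ (2 * P.card : ℝ) ^ r / N := by
  set h : ℝ := ∑ p ∈ P, (p : ℝ)⁻¹ with hh
  have h0 : 0 ≤ h := Finset.sum_nonneg fun p _ => by positivity
  have h1 : h ≤ P.card := by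
    rw [hh, Finset.card_eq_sum_ones, Nat.cast_sum]
    refine Finset.sum_le_sum fun p hp => ?_
    rw [Nat.cast_one]
    exact inv_le_one_of_one_le₀ (by exact_mod_cast (hP p hp).one_le)
  have hpow : ∀ c : ℝ, (c - h) ^ r =
      ∑ j ∈ Finset.range (r + 1), ((-h) ^ (r - j) * (r.choose j : ℝ)) * c ^ j := by
    intro c
    rw [sub_eq_add_neg, add_pow]
    exact Finset.sum_congr rfl fun j _ => by ring
  have key : ∀ j, |uniformMean N (fun n => ((P.filter (· ∣ n)).card : ℝ) ^ j) -
      bernoulliExpect (fun p : ℕ => (p : ℝ)⁻¹) P (fun D => (D.card : ℝ) ^ j)| ≤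
      (P.card : ℝ) ^ j / N := by
    intro j
    simpa using abs_uniformMean_card_pow_sub_le hP hN j ∅ (Finset.empty_subset P)
  unfold bernoulliCentralMoment
  rw [← hh]
  simp only [hpow]
  rw [uniformMean_sum, bernoulliExpect_sum, ← Finset.sum_sub_distrib]
  simp only [uniformMean_const_mul, bernoulliExpect_const_mul, ← mul_sub]
  calc _ ≤ ∑ j ∈ Finset.range (r + 1), (h ^ (r - j) * (r.choose j : ℝ)) * (P.card ^ j / N) := by
        refine (Finset.abs_sum_le_sum_abs _ _).trans (Finset.sum_le_sum fun j _ => ?_)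
        rw [abs_mul, abs_mul, abs_pow, abs_neg, abs_of_nonneg h0, Nat.abs_cast]
        gcongr
        exact key j
    _ = (P.card + h) ^ r / N := by
        rw [add_pow, Finset.sum_div]
        exact Finset.sum_congr rfl fun j _ => by ring
    _ ≤ (2 * P.card : ℝ) ^ r / N := by
        gcongr
        linarith

/-! ### Truncation to small primes -/

theorem exists_abs_sum_inv_primesLE_nthRoot_sub_log_log_le {s : ℕ} (hs : s ≠ 0) :
    ∃ C : ℝ, ∀ᶠ N : ℕ in atTop,
      |∑ p ∈ (Nat.nthRoot s N).primesLE, (p : ℝ)⁻¹ - Real.log (Real.log N)| ≤ C := by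
  obtain ⟨C, hC⟩ := exists_abs_sum_inv_primesLE_sub_log_log_le
  refine ⟨C + Real.log (2 * s), ?_⟩
  filter_upwards [eventually_ge_atTop (2 ^ s)] with N hN
  have hy : 2 ≤ Nat.nthRoot s N := (Nat.le_nthRoot_iff hs).2 hN
  have hy1 : Nat.nthRoot s N ^ s ≤ N := (Nat.le_nthRoot_iff hs).1 le_rfl
  have hy2 : N < (Nat.nthRoot s N + 1) ^ s := Nat.lt_pow_nthRoot_add_one hs N
  have hm := hC _ hy
  set y := Nat.nthRoot s N
  have hyR : (2 : ℝ) ≤ y := by exact_mod_cast hy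
  have hNpos : (0 : ℝ) < N := by
    have : 0 < N := (pow_pos (by norm_num) s).trans_le hN
    exact_mod_cast this
  have hly : 0 < Real.log y := Real.log_pos (by linarith)
  have hs1 : (1 : ℝ) ≤ s := by exact_mod_cast Nat.one_le_iff_ne_zero.2 hs
  have h1 : s * Real.log y ≤ Real.log N := by
    rw [← Real.log_pow]
    exact Real.log_le_log (by positivity) (by exact_mod_cast hy1)
  have h2 : Real.log N ≤ 2 * s * Real.log y := by
    have : (N : ℝ) ≤ (y : ℝ) ^ (2 * s) := by
      rw [pow_mul]
      calc (N : ℝ) ≤ ((y + 1 : ℕ) : ℝ) ^ s := by exact_mod_cast hy2.le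
        _ ≤ _ := by
          push_cast
          gcongr
          nlinarith
    have := Real.log_le_log hNpos this
    rw [Real.log_pow] at this
    push_cast at this
    exact this
  have h3 : Real.log y ≤ Real.log N := by nlinarith
  have h4 := Real.log_le_log hly h3
  have h5 := Real.log_le_log (hly.trans_le h3) h2
  rw [Real.log_mul (by positivity) hly.ne'] at h5
  rw [abs_le] at hm ⊢
  constructor <;> linarith

/-- An integer `n < (y + 1) ^ s` has fewer than `s` prime factors exceeding `y`. -/
theorem abs_cardDistinctFactors_sub_card_filter_le {n y s : ℕ} (hn : n ≠ 0)
    (hns : n < (y + 1) ^ s) :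
    |(ArithmeticFunction.cardDistinctFactors n : ℝ) - (y.primesLE.filter (· ∣ n)).card| ≤ s := by
  have e : y.primesLE.filter (· ∣ n) = n.primeFactors.filter (· ≤ y) := by
    ext p
    simp only [Finset.mem_filter, Nat.mem_primesLE, Nat.mem_primeFactors]
    tauto
  have hw : ArithmeticFunction.cardDistinctFactors n = n.primeFactors.card := rfl
  have hsplit := Finset.card_filter_add_card_filter_not (s := n.primeFactors) (p := (· ≤ y))
  have hR : (n.primeFactors.filter (¬ · ≤ y)).card < s := by
    have h1 : (y + 1) ^ (n.primeFactors.filter (¬ · ≤ y)).card ≤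
        ∏ p ∈ n.primeFactors.filter (¬ · ≤ y), p := by
      refine Finset.pow_card_le_prod _ _ _ fun p hp => ?_
      have := (Finset.mem_filter.1 hp).2
      omega
    have h2 : ∏ p ∈ n.primeFactors.filter (¬ · ≤ y), p ∣ n :=
      (Finset.prod_dvd_prod_of_subset _ _ _ (Finset.filter_subset _ _)).trans
        (Nat.prod_primeFactors_dvd n)
    have h3 := (h1.trans (Nat.le_of_dvd (Nat.pos_of_ne_zero hn) h2)).trans_lt hns
    exact (Nat.pow_lt_pow_iff_right (a := y + 1) (by
      rcases y with _ | y
      · simp at h3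
      · omega)).1 h3
  rw [e, hw, ← hsplit, Nat.cast_add, add_sub_cancel_left, Nat.abs_cast]
  exact_mod_cast hR.le

/-! ### Convergence of the moments -/

/-- A bounded shift changes an even power by an arbitrarily small multiple of itself, up to a
constant. -/
theorem exists_abs_add_pow_sub_pow_le (k : ℕ) {C δ : ℝ} (hδ : 0 < δ) :
    ∃ K : ℝ, ∀ s t : ℝ, |t| ≤ C → |(s + t) ^ (2 * k) - s ^ (2 * k)| ≤ δ * s ^ (2 * k) + K := by
  have hcont : ContinuousAt (fun u : ℝ => (1 + u) ^ (2 * k)) 0 := by fun_prop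
  obtain ⟨η, hη, hηδ⟩ := Metric.continuousAt_iff.1 hcont δ hδ
  refine ⟨(C / η + 1 + C) ^ (2 * k) + (C / η + 1) ^ (2 * k), fun s t ht => ?_⟩
  have hC : 0 ≤ C := (abs_nonneg t).trans ht
  have hs2 : 0 ≤ s ^ (2 * k) := (even_two_mul k).pow_nonneg s
  rcases lt_or_ge |s| (C / η + 1) with hs | hs
  · have h1 : |(s + t) ^ (2 * k)| ≤ (C / η + 1 + C) ^ (2 * k) := by
      rw [abs_pow]
      gcongr
      exact (abs_add_le _ _).trans (add_le_add hs.le ht)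
    have h2 : |s ^ (2 * k)| ≤ (C / η + 1) ^ (2 * k) := by
      rw [abs_pow]
      gcongr
    have := abs_sub ((s + t) ^ (2 * k)) (s ^ (2 * k))
    nlinarith
  · have hCη : 0 ≤ C / η := by positivity
    have hs0 : 0 < |s| := by linarith
    have hsne : s ≠ 0 := abs_pos.1 hs0
    have hu : dist (t / s) 0 < η := by
      rw [Real.dist_eq, sub_zero, abs_div, div_lt_iff₀ hs0]
      calc |t| ≤ C := ht
        _ = η * (C / η) := by field_simp
        _ < η * |s| := by gcongr; linarith
    have h := hηδ hu
    rw [Real.dist_eq, add_zero, one_pow] at h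
    have e : (s + t) ^ (2 * k) - s ^ (2 * k) = s ^ (2 * k) * ((1 + t / s) ^ (2 * k) - 1) := by
      rw [mul_sub, ← mul_pow, mul_one, mul_add, mul_one, mul_div_cancel₀ _ hsne]
    rw [e, abs_mul, abs_of_nonneg hs2]
    have : 0 ≤ (C / η + 1 + C) ^ (2 * k) + (C / η + 1) ^ (2 * k) := by positivity
    nlinarith

theorem tendsto_log_log_natCast_atTop :
    Tendsto (fun N : ℕ => Real.log (Real.log N)) atTop atTop :=
  Real.tendsto_log_atTop.comp (Real.tendsto_log_atTop.comp tendsto_natCast_atTop_atTop)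

theorem tendsto_of_abs_sub_le_mul_add {a b e : ℕ → ℝ} {m : ℝ} (hb : Tendsto b atTop (nhds m))
    (he : Tendsto e atTop (nhds 0))
    (h : ∀ δ : ℝ, 0 < δ → ∃ K : ℝ, ∀ᶠ N in atTop, |a N - b N| ≤ δ * b N + K * e N) :
    Tendsto a atTop (nhds m) := by
  have h0 : Tendsto (fun N => a N - b N) atTop (nhds 0) := by
    rw [Metric.tendsto_nhds]
    intro ε hε
    have hm : 0 < |m| + 1 := by positivity
    obtain ⟨K, hK⟩ := h (ε / (2 * (|m| + 1))) (by positivity)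
    have hlim : Tendsto (fun N => ε / (2 * (|m| + 1)) * b N + K * e N) atTop
        (nhds (ε / (2 * (|m| + 1)) * m + K * 0)) := (hb.const_mul _).add (he.const_mul K)
    have hlt : ε / (2 * (|m| + 1)) * m + K * 0 < ε := by
      have h1 : ε / (2 * (|m| + 1)) * m ≤ ε / (2 * (|m| + 1)) * (|m| + 1) := by
        gcongr
        linarith [le_abs_self m]
      have h2 : ε / (2 * (|m| + 1)) * (|m| + 1) = ε / 2 := by field_simp
      linarith
    filter_upwards [hK, hlim.eventually_lt_const hlt] with N h1 h2
    rw [Real.dist_eq, sub_zero]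
    linarith
  simpa using h0.add hb

/-- The even moments of the number of prime factors up to `N ^ (1 / (2 k + 1))`, centred at their
expected number. -/
theorem tendsto_uniformMean_truncated {k : ℕ} (hk : k ≠ 0) :
    Tendsto (fun N : ℕ => uniformMean N (fun n =>
      ((((Nat.nthRoot (2 * k + 1) N).primesLE.filter (· ∣ n)).card : ℝ) -
        ∑ p ∈ (Nat.nthRoot (2 * k + 1) N).primesLE, (p : ℝ)⁻¹) ^ (2 * k)) /
      Real.log (Real.log N) ^ k) atTop (nhds (gaussianMoment k)) := by
  set x : ℕ → ℝ := fun p => (p : ℝ)⁻¹ with hxdef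
  have hx : ∀ p, 0 ≤ x p ∧ x p ≤ 1 := fun p => ⟨by positivity, Nat.cast_inv_le_one p⟩
  set P : ℕ → Finset ℕ := fun N => (Nat.nthRoot (2 * k + 1) N).primesLE with hP
  set L : ℕ → ℝ := fun N => Real.log (Real.log N) with hL
  set V : ℕ → ℝ := fun N => bernoulliVariance x (P N) with hV
  set m : ℕ → ℝ := fun N => uniformMean N (fun n =>
      ((((P N).filter (· ∣ n)).card : ℝ) - ∑ p ∈ P N, (p : ℝ)⁻¹) ^ (2 * k)) with hm
  have hLtop : Tendsto L atTop atTop := tendsto_log_log_natCast_atTop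
  have hL1 : ∀ᶠ N in atTop, 1 ≤ L N := hLtop.eventually_ge_atTop 1
  have hLinv : Tendsto (fun N => (L N)⁻¹) atTop (nhds 0) := hLtop.inv_tendsto_atTop
  obtain ⟨C, hC⟩ := exists_abs_sum_inv_primesLE_nthRoot_sub_log_log_le
    (Nat.succ_ne_zero (2 * k))
  obtain ⟨C₂, hC₂⟩ := exists_sum_inv_sq_primesLE_le
  obtain ⟨C₃, hC₃0, hC₃⟩ := exists_abs_bernoulliCentralMoment_sub_le hx (2 * k)
  have hVL : ∀ᶠ N in atTop, |V N - L N| ≤ C + C₂ := by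
    filter_upwards [hC] with N hN
    have e : V N = ∑ p ∈ P N, (p : ℝ)⁻¹ - ∑ p ∈ P N, ((p : ℝ)⁻¹) ^ 2 := by
      simp only [hV, bernoulliVariance, hxdef]
      rw [← Finset.sum_sub_distrib]
      exact Finset.sum_congr rfl fun p _ => by ring
    have h1 := hC₂ (Nat.nthRoot (2 * k + 1) N)
    have h2 : 0 ≤ ∑ p ∈ P N, ((p : ℝ)⁻¹) ^ 2 := Finset.sum_nonneg fun p _ => by positivity
    rw [abs_le] at hN ⊢
    rw [e]
    constructor <;> simp only [hP, hL] at * <;> linarith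
  have hq : Tendsto (fun N => V N / L N) atTop (nhds 1) := by
    have h0 : Tendsto (fun N => (V N - L N) * (L N)⁻¹) atTop (nhds 0) := by
      refine squeeze_zero_norm' (a := fun N => (C + C₂) * (L N)⁻¹) ?_ ?_
      · filter_upwards [hVL, hL1] with N h1 h2
        rw [norm_mul, Real.norm_eq_abs, Real.norm_of_nonneg (inv_nonneg.2 (by linarith))]
        exact mul_le_mul_of_nonneg_right h1 (inv_nonneg.2 (by linarith))
      · simpa using hLinv.const_mul (C + C₂)
    refine Tendsto.congr' ?_ (by simpa using h0.add_const 1)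
    filter_upwards [hL1] with N h2
    have : L N ≠ 0 := by linarith
    field_simp
    ring
  have hcomp : ∀ᶠ N in atTop, |m N - gaussianMoment k * V N ^ k| ≤
      4 ^ k + C₃ * (1 + V N) ^ (k - 1) := by
    filter_upwards [eventually_ge_atTop 1] with N hN
    have hN0 : (0 : ℝ) < N := by exact_mod_cast hN
    have h1 := abs_uniformMean_central_sub_le (P := P N)
      (fun p hp => Nat.prime_of_mem_primesLE hp) (Nat.one_le_iff_ne_zero.1 hN) (2 * k)
    have h2 : (2 * (P N).card : ℝ) ^ (2 * k) / N ≤ 4 ^ k := by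
      have hy : 1 ≤ Nat.nthRoot (2 * k + 1) N := (Nat.le_nthRoot_iff (by omega)).2 (by simpa)
      have hcard : (P N).card ^ (2 * k) ≤ N := calc
        (P N).card ^ (2 * k) ≤ (Nat.nthRoot (2 * k + 1) N) ^ (2 * k) := by
          refine Nat.pow_le_pow_left ?_ _
          simp only [hP, Nat.primesLE_eq_filter_Icc_one]
          exact (Finset.card_filter_le _ _).trans (by simp)
        _ ≤ (Nat.nthRoot (2 * k + 1) N) ^ (2 * k + 1) := Nat.pow_le_pow_right hy (by omega)
        _ ≤ N := (Nat.le_nthRoot_iff (by omega)).1 le_rfl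
      have hcardR : ((P N).card : ℝ) ^ (2 * k) ≤ N := by exact_mod_cast hcard
      rw [div_le_iff₀ hN0, mul_pow, pow_mul]
      norm_num
      exact hcardR
    have hVN : 0 ≤ V N := bernoulliVariance_nonneg hx _
    have h3 : |bernoulliCentralMoment x (2 * k) (P N) - gaussianMoment k * V N ^ k| ≤
        C₃ * (1 + V N) ^ (k - 1) := by
      have h := hC₃ (P N)
      have e1 : (2 * k + 1) / 2 = k - 1 + 1 := by omega
      have e2 : 2 * k / 2 = k := by omega
      rw [gaussianMomentVar, if_pos (even_two_mul k), e1, e2, pow_succ, ← mul_assoc] at h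
      exact le_of_mul_le_mul_right h (by linarith)
    have h4 := abs_add_le (m N - bernoulliCentralMoment x (2 * k) (P N))
      (bernoulliCentralMoment x (2 * k) (P N) - gaussianMoment k * V N ^ k)
    rw [sub_add_sub_cancel] at h4
    linarith [h1.trans h2]
  have hdiff : Tendsto (fun N => (m N - gaussianMoment k * V N ^ k) / L N ^ k) atTop
      (nhds 0) := by
    obtain ⟨j, rfl⟩ := Nat.exists_eq_succ_of_ne_zero hk
    refine squeeze_zero_norm' (a := fun N => 4 ^ (j + 1) * (L N)⁻¹ ^ (j + 1) +
      C₃ * ((L N)⁻¹ + V N / L N) ^ j * (L N)⁻¹) ?_ ?_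
    · filter_upwards [hcomp, hL1] with N h1 h2
      have hLpos : 0 < L N := by linarith
      rw [Real.norm_eq_abs, abs_div, abs_of_pos (pow_pos hLpos _), div_le_iff₀ (pow_pos hLpos _)]
      refine h1.trans_eq ?_
      have e : (L N)⁻¹ + V N / L N = (1 + V N) * (L N)⁻¹ := by ring
      rw [e, Nat.succ_eq_add_one, Nat.add_sub_cancel, mul_pow]
      have h5 : (L N)⁻¹ ^ j * (L N) ^ j = 1 := by
        rw [← mul_pow, inv_mul_cancel₀ hLpos.ne', one_pow]
      have h6 : (L N)⁻¹ * L N = 1 := inv_mul_cancel₀ hLpos.ne'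
      rw [pow_succ (L N)⁻¹, pow_succ (L N)]
      linear_combination (-(4 ^ (j + 1)) - C₃ * (1 + V N) ^ j) * (L N)⁻¹ * L N * h5 +
        (-(4 ^ (j + 1)) - C₃ * (1 + V N) ^ j) * h6
    · have := ((hLinv.pow (j + 1)).const_mul (4 ^ (j + 1))).add
        ((((hLinv.add hq).pow j).const_mul C₃).mul hLinv)
      simpa using this
  have hfin := hdiff.add ((hq.pow k).const_mul (gaussianMoment k))
  simp only [one_pow, mul_one, zero_add] at hfin
  refine hfin.congr fun N => ?_
  change _ = m N / L N ^ k
  rw [div_pow]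
  ring

/-- The even moments of `normalizedOmega` converge to those of a standard Gaussian variable. -/
theorem tendsto_uniformMean_normalizedOmega_pow (k : ℕ) :
    Tendsto (fun N : ℕ => uniformMean N (fun n => normalizedOmega N n ^ (2 * k))) atTop
      (nhds (gaussianMoment k)) := by
  rcases eq_or_ne k 0 with rfl | hk
  · rw [gaussianMoment_zero]
    refine tendsto_const_nhds.congr' ?_
    filter_upwards [eventually_ne_atTop 0] with N hN
    simp [uniformMean_const hN]
  have hb := tendsto_uniformMean_truncated hk
  have he : Tendsto (fun N : ℕ => (Real.log (Real.log N) ^ k)⁻¹) atTop (nhds 0) :=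
    ((tendsto_pow_atTop hk).comp tendsto_log_log_natCast_atTop).inv_tendsto_atTop
  refine tendsto_of_abs_sub_le_mul_add hb he fun δ hδ => ?_
  obtain ⟨C, hC⟩ := exists_abs_sum_inv_primesLE_nthRoot_sub_log_log_le
    (Nat.succ_ne_zero (2 * k))
  obtain ⟨K, hK⟩ := exists_abs_add_pow_sub_pow_le k (C := (2 * k + 1 : ℕ) + C) hδ
  refine ⟨K, ?_⟩
  filter_upwards [hC, eventually_ne_atTop 0, tendsto_log_log_natCast_atTop.eventually_gt_atTop 0]
    with N hCN hN hLN
  set P := (Nat.nthRoot (2 * k + 1) N).primesLE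
  set L := Real.log (Real.log N) with hL
  set h := ∑ p ∈ P, (p : ℝ)⁻¹
  have e : uniformMean N (fun n => normalizedOmega N n ^ (2 * k)) =
      uniformMean N (fun n =>
        ((ArithmeticFunction.cardDistinctFactors n : ℝ) - L) ^ (2 * k)) / L ^ k := by
    rw [div_eq_inv_mul, ← uniformMean_const_mul]
    congr 1
    funext n
    rw [normalizedOmega, ← hL, div_pow, pow_mul (Real.sqrt L), Real.sq_sqrt hLN.le, div_eq_inv_mul]
  have hdiff : |uniformMean N (fun n =>
        ((ArithmeticFunction.cardDistinctFactors n : ℝ) - L) ^ (2 * k)) -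
      uniformMean N (fun n => (((P.filter (· ∣ n)).card : ℝ) - h) ^ (2 * k))| ≤
      uniformMean N (fun n => δ * (((P.filter (· ∣ n)).card : ℝ) - h) ^ (2 * k) + K) := by
    refine abs_uniformMean_sub_le fun n hn => ?_
    have hn' := Finset.mem_Icc.1 hn
    have hw := abs_cardDistinctFactors_sub_card_filter_le (n := n)
      (y := Nat.nthRoot (2 * k + 1) N) (s := 2 * k + 1) (by omega)
      (hn'.2.trans_lt (Nat.lt_pow_nthRoot_add_one (by omega) N))
    have ht := (abs_add_le ((ArithmeticFunction.cardDistinctFactors n : ℝ) -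
      (P.filter (· ∣ n)).card) (h - L)).trans (add_le_add hw hCN)
    have := hK (((P.filter (· ∣ n)).card : ℝ) - h) _ ht
    refine le_trans (le_of_eq ?_) this
    congr 3
    ring
  rw [uniformMean_add, uniformMean_const_mul, uniformMean_const hN] at hdiff
  have hLk : 0 < L ^ k := pow_pos hLN k
  rw [e, ← sub_div, abs_div, abs_of_pos hLk, div_le_iff₀ hLk]
  refine hdiff.trans_eq ?_
  field_simp

/-! ### Moment bounds for the tail -/

theorem momentBound_two_mul (k : ℕ) (A : ℝ) :
    momentBound (2 * k) A = gaussianMoment k / (A ^ 2) ^ k := by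
  rw [momentBound, gaussianMoment, Nat.mul_div_cancel_left k two_pos, pow_mul, div_div]

theorem omegaTail_le_uniformMean {N : ℕ} {A : ℝ} {f : ℕ → ℝ} (h0 : ∀ n, 0 ≤ f n)
    (h1 : ∀ n, A < |normalizedOmega N n| → 1 ≤ f n) :
    omegaTail N A ≤ uniformMean N f := by
  classical
  have e : omegaTail N A =
      uniformMean N (fun n => if A < |normalizedOmega N n| then 1 else 0) := by
    unfold omegaTail uniformMean
    rw [MeasureTheory.measureReal_def,
      ← ProbabilityTheory.uniformOn_inter_self (Set.finite_Icc 1 N)]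
    have hs : Set.Icc 1 N ∩ {n : ℕ | A < |normalizedOmega N n|} =
        (((Finset.Icc 1 N).filter fun n => A < |normalizedOmega N n| : Finset ℕ) : Set ℕ) := by
      ext n; simp
    rw [hs, ← Finset.coe_Icc, ProbabilityTheory.uniformOn_apply_finset,
      Finset.inter_eq_right.2 (Finset.filter_subset _ _), Finset.sum_boole]
    simp
  rw [e]
  refine uniformMean_mono fun n _ => ?_
  split_ifs with h
  · exact h1 n h
  · exact h0 n

theorem eventually_omegaTail_lt (k : ℕ) {ε : ℝ} (hε : 0 < ε) :
    ∃ N₀ : ℕ, ∀ N : ℕ, N₀ ≤ N → ∀ A : ℝ, 0 < A →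
      omegaTail N A < (1 + ε) * momentBound (2 * k) A := by
  have hlt : gaussianMoment k < (1 + ε) * gaussianMoment k := by
    nlinarith [gaussianMoment_pos k]
  obtain ⟨N₀, hN₀⟩ := eventually_atTop.1
    ((tendsto_uniformMean_normalizedOmega_pow k).eventually_lt_const hlt)
  refine ⟨N₀, fun N hN A hA => ?_⟩
  have hAk : 0 < (A ^ 2) ^ k := by positivity
  have h := omegaTail_le_uniformMean (N := N) (A := A)
    (f := fun n => ((A ^ 2) ^ k)⁻¹ * normalizedOmega N n ^ (2 * k))
    (fun n => mul_nonneg (by positivity) ((even_two_mul k).pow_nonneg _)) (fun n hn => by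
      rw [← div_eq_inv_mul, one_le_div hAk, ← pow_mul,
        ← (even_two_mul k).pow_abs (normalizedOmega N n)]
      gcongr)
  rw [uniformMean_const_mul] at h
  refine h.trans_lt ?_
  rw [momentBound_two_mul, ← mul_div_assoc, ← div_eq_inv_mul]
  gcongr
  exact hN₀ N hN

/-! ### The optimal order -/

theorem exists_optimalOrder_eq_two_mul (A : ℝ) :
    ∃ K : ℕ, optimalOrder A = 2 * K ∧ (2 * K : ℝ) < 1 + A ^ 2 ∧ A ^ 2 ≤ 2 * K + 1 := by
  obtain ⟨⟨⟨K, hK⟩, hlt⟩, hmax⟩ := optimalOrder_isGreatest A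
  refine ⟨K, by omega, by rw [hK] at hlt; push_cast at hlt; linarith, ?_⟩
  by_contra! h
  have h1 : K + K + 2 ≤ optimalOrder A := hmax ⟨⟨K + 1, by ring⟩, by push_cast; linarith⟩
  omega

theorem gaussianMoment_div_pow_succ (k : ℕ) {t : ℝ} (ht : 0 < t) :
    gaussianMoment (k + 1) / t ^ (k + 1) = gaussianMoment k / t ^ k * ((2 * k + 1) / t) := by
  rw [gaussianMoment_succ, pow_succ]
  field_simp

/-- As a function of `k`, the ratio of consecutive bounds is `(2 k + 1) / t`, so the bound decreases
up to the optimal order and increases afterwards. -/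
theorem gaussianMoment_div_pow_le {K : ℕ} {t : ℝ} (ht : 0 < t) (h1 : (2 * K : ℝ) < 1 + t)
    (h2 : t ≤ 2 * K + 1) (k : ℕ) : gaussianMoment K / t ^ K ≤ gaussianMoment k / t ^ k := by
  have hpos : ∀ j, 0 ≤ gaussianMoment j / t ^ j := fun j =>
    div_nonneg (gaussianMoment_pos j).le (by positivity)
  rcases le_total K k with h | h
  · induction k, h using Nat.le_induction with
    | base => exact le_rfl
    | succ k hk ih =>
      rw [gaussianMoment_div_pow_succ k ht]
      refine ih.trans (le_mul_of_one_le_right (hpos k) ((one_le_div ht).2 ?_))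
      have : (K : ℝ) ≤ k := by exact_mod_cast hk
      linarith
  · induction h using Nat.decreasingInduction with
    | self => exact le_rfl
    | of_succ k hk ih =>
      refine ih.trans ?_
      rw [gaussianMoment_div_pow_succ k ht]
      refine mul_le_of_le_one_right (hpos k) ((div_le_one ht).2 ?_)
      have : ((k + 1 : ℕ) : ℝ) ≤ K := by exact_mod_cast hk
      push_cast at this
      linarith

/-! ### The size of the optimal bound -/

theorem gaussianMoment_eq_stirlingSeq {k : ℕ} (hk : k ≠ 0) :
    gaussianMoment k = Stirling.stirlingSeq (2 * k) / Stirling.stirlingSeq k *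
      (Real.sqrt 2 * (2 * k / Real.exp 1) ^ k) := by
  have hk0 : (0 : ℝ) < k := by exact_mod_cast Nat.pos_of_ne_zero hk
  have hs : Real.sqrt (2 * ((2 * k : ℕ) : ℝ)) = Real.sqrt 2 * Real.sqrt (2 * k) := by
    push_cast
    rw [Real.sqrt_mul (by norm_num)]
  have h2 : Real.sqrt (2 * k) ≠ 0 := (Real.sqrt_pos.2 (by positivity)).ne'
  have h3 : Real.sqrt 2 ≠ 0 := by positivity
  have hf : (k.factorial : ℝ) ≠ 0 := by exact_mod_cast k.factorial_ne_zero
  rw [gaussianMoment, Stirling.stirlingSeq, Stirling.stirlingSeq, hs]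
  push_cast
  have he : Real.exp 1 ≠ 0 := Real.exp_ne_zero 1
  generalize Real.exp 1 = e at he ⊢
  simp only [div_pow, mul_pow, pow_mul']
  field_simp

/-- Stirling's formula for Gaussian moments, as a relative error to `√2 exp (-t / 2)`. -/
theorem gaussianMoment_div_pow_eq {k : ℕ} (hk : k ≠ 0) {t : ℝ} (ht : 0 < t) :
    gaussianMoment k / t ^ k = Stirling.stirlingSeq (2 * k) / Stirling.stirlingSeq k *
      Real.exp (t / 2 - k - k * Real.log (t / (2 * k))) *
        (Real.sqrt 2 * Real.exp (-(t / 2))) := by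
  have hk0 : (0 : ℝ) < k := by exact_mod_cast Nat.pos_of_ne_zero hk
  have h1 : Real.exp (t / 2 - k - k * Real.log (t / (2 * k))) * Real.exp (-(t / 2)) =
      (2 * k / Real.exp 1) ^ k / t ^ k := by
    rw [← Real.exp_add,
      show t / 2 - k - k * Real.log (t / (2 * k)) + -(t / 2) =
        -(k * 1) - k * Real.log (t / (2 * k)) by ring, Real.exp_sub, Real.exp_neg, Real.exp_nat_mul,
      Real.exp_nat_mul, Real.exp_log (by positivity), div_pow, div_pow]
    field_simp
  rw [gaussianMoment_eq_stirlingSeq hk]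
  linear_combination (-(Stirling.stirlingSeq (2 * k) / Stirling.stirlingSeq k * Real.sqrt 2)) * h1

theorem stirlingSeq_two_mul_div_le_one {k : ℕ} (hk : k ≠ 0) :
    Stirling.stirlingSeq (2 * k) / Stirling.stirlingSeq k ≤ 1 := by
  obtain ⟨j, rfl⟩ := Nat.exists_eq_succ_of_ne_zero hk
  rw [div_le_one (Stirling.stirlingSeq'_pos j)]
  exact Stirling.stirlingSeq'_antitone (show j ≤ 2 * j + 1 by omega)

theorem tendsto_stirlingSeq_two_mul_div :
    Tendsto (fun k : ℕ => Stirling.stirlingSeq (2 * k) / Stirling.stirlingSeq k) atTop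
      (nhds 1) := by
  have h := Stirling.tendsto_stirlingSeq_sqrt_pi
  have h2 : Tendsto (fun k : ℕ => Stirling.stirlingSeq (2 * k)) atTop
      (nhds (Real.sqrt Real.pi)) :=
    h.comp (tendsto_id.const_mul_atTop' two_pos)
  have hpi : Real.sqrt Real.pi ≠ 0 := (Real.sqrt_pos.2 Real.pi_pos).ne'
  have h3 := h2.div h hpi
  rwa [div_self hpi] at h3

theorem sub_two_mul_sq_le_log_one_add {x : ℝ} (hx : -(1 / 2) ≤ x) :
    x - 2 * x ^ 2 ≤ Real.log (1 + x) := by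
  have hpos : 0 < 1 + x := by linarith
  refine le_trans ?_ (Real.one_sub_inv_le_log_of_pos hpos)
  have : 1 - (1 + x)⁻¹ = x / (1 + x) := by field_simp; ring
  rw [this, le_div_iff₀ hpos]
  nlinarith [mul_nonneg (sq_nonneg x) (show 0 ≤ 1 + 2 * x by linarith)]

theorem isEquivalent_momentBound_optimalOrder :
    (fun A : ℝ => momentBound (optimalOrder A) A) ~[atTop]
      fun A : ℝ => Real.sqrt 2 * Real.exp (-(A ^ 2 / 2)) := by
  choose K hK hK1 hK2 using exists_optimalOrder_eq_two_mul
  have hKtop : Tendsto K atTop atTop := by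
    rw [← tendsto_natCast_atTop_iff (R := ℝ)]
    refine tendsto_atTop_mono (f := fun A : ℝ => (A ^ 2 - 1) / 2) (fun A => ?_) ?_
    · linarith [hK2 A]
    · exact (tendsto_atTop_add_const_right _ _ (tendsto_pow_atTop two_ne_zero)).atTop_div_const
        two_pos
  have hexp : Tendsto (fun A : ℝ => A ^ 2 / 2 - K A - K A * Real.log (A ^ 2 / (2 * K A))) atTop
      (nhds 0) := by
    have hinv : Tendsto (fun A : ℝ => ((K A : ℝ))⁻¹ * (1 / 2)) atTop (nhds 0) := by
      simpa using ((tendsto_natCast_atTop_atTop (R := ℝ)).comp hKtop).inv_tendsto_atTop.mul_const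
        (1 / 2 : ℝ)
    refine squeeze_zero' ?_ ?_ hinv <;>
    · filter_upwards [hKtop.eventually_ge_atTop 1] with A hA
      have hk : (1 : ℝ) ≤ K A := by exact_mod_cast hA
      -- `A ^ 2 = 2 K (1 + x)` with `|2 K x| ≤ 1`
      set x : ℝ := (A ^ 2 - 2 * K A) / (2 * K A) with hx
      have hkx : 2 * K A * x = A ^ 2 - 2 * K A := by rw [hx]; field_simp
      have hAx : A ^ 2 / (2 * K A) = 1 + x := by rw [hx]; field_simp; ring
      have hx1 : -1 ≤ 2 * K A * x := by linarith [hK1 A]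
      have hx2 : 2 * K A * x ≤ 1 := by linarith [hK2 A]
      have hxh : -(1 / 2) ≤ x := by nlinarith
      have hl := sub_two_mul_sq_le_log_one_add hxh
      have hu := Real.log_le_sub_one_of_pos (show 0 < 1 + x by linarith)
      have hsq : (2 * K A * x) ^ 2 ≤ 1 := (sq_le_one_iff_abs_le_one _).2 (abs_le.2 ⟨hx1, hx2⟩)
      rw [hAx]
      first
        | nlinarith
        | have h1 : (K A : ℝ) * (x - 2 * x ^ 2) ≤ K A * Real.log (1 + x) := by gcongr
          rw [inv_mul_eq_div, le_div_iff₀ (by linarith)]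
          nlinarith [mul_le_mul_of_nonneg_right h1 (show (0 : ℝ) ≤ K A by linarith)]
  have hpos : ∀ A : ℝ, Real.sqrt 2 * Real.exp (-(A ^ 2 / 2)) ≠ 0 := fun A => by positivity
  refine (isEquivalent_iff_tendsto_one (Eventually.of_forall hpos)).2 ?_
  have hlim := (tendsto_stirlingSeq_two_mul_div.comp hKtop).mul
    ((Real.continuous_exp.tendsto 0).comp hexp)
  rw [Real.exp_zero, mul_one] at hlim
  refine hlim.congr' ?_
  filter_upwards [eventually_gt_atTop 0, hKtop.eventually_ne_atTop 0] with A hA hA2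
  rw [Pi.div_apply, eq_div_iff (hpos A), hK, momentBound_two_mul,
    gaussianMoment_div_pow_eq hA2 (pow_pos hA 2)]
  rfl

/-! ### A tail bound below the optimal moment bound -/

/-- If `t` exceeds `2 k + 1` by `s ∈ [12, 14]`, then the bound of order `2 k` at `A = √t` becomes
smaller than `√2 exp (-t / 2)` on multiplication by `2 m / (2 m + s ^ 2)`, where `m = 2 k + 1`. -/
theorem gaussianMoment_div_pow_mul_lt {k : ℕ} {s t : ℝ} (hk : 200 ≤ k) (hs1 : 12 ≤ s)
    (hs2 : s ≤ 14) (ht : t = 2 * k + 1 + s) :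
    gaussianMoment k / t ^ k * (2 * (2 * k + 1) / (2 * (2 * k + 1) + s ^ 2)) <
      Real.sqrt 2 * Real.exp (-(t / 2)) := by
  have hkR : (200 : ℝ) ≤ k := by exact_mod_cast hk
  have hk0 : k ≠ 0 := by omega
  have ht0 : 0 < t := by linarith
  set x : ℝ := (s + 1) / (2 * k) with hx
  have hx0 : 0 ≤ x := by positivity
  have hkx : 2 * k * x = s + 1 := by rw [hx]; field_simp
  have htx : t / (2 * k) = 1 + x := by rw [hx, ht]; field_simp; ring
  have hlog : x - x ^ 2 / 2 ≤ Real.log (1 + x) := by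
    refine le_trans ?_ (Real.le_log_one_add_of_nonneg hx0)
    rw [le_div_iff₀ (by linarith)]
    nlinarith [pow_nonneg hx0 3]
  set E : ℝ := t / 2 - k - k * Real.log (t / (2 * k)) with hE
  have hE8 : 8 * k * E ≤ 225 := by
    have h1 : (k : ℝ) * (x - x ^ 2 / 2) ≤ k * Real.log (1 + x) := by gcongr
    have h2 : E ≤ k * x ^ 2 / 2 := by
      rw [hE, htx]
      linarith
    calc 8 * k * E ≤ 8 * k * (k * x ^ 2 / 2) := by gcongr
      _ = (2 * k * x) ^ 2 := by ring
      _ = (s + 1) ^ 2 := by rw [hkx]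
      _ ≤ 225 := by nlinarith
  have hs2' : s ^ 2 ≤ 196 := by nlinarith
  have hs1' : 144 ≤ s ^ 2 := by nlinarith
  have hm : 0 < 2 * (2 * (k : ℝ) + 1) + s ^ 2 := by positivity
  have hratio : 2 * (2 * (k : ℝ) + 1) / (2 * (2 * k + 1) + s ^ 2) < Real.exp (-E) := by
    refine lt_of_lt_of_le ?_ (Real.add_one_le_exp (-E))
    rw [div_lt_iff₀ hm]
    have hE1 : E ≤ 225 / (8 * k) := by rw [le_div_iff₀ (by positivity)]; linarith
    have h3 : E * (2 * (2 * (k : ℝ) + 1) + s ^ 2) ≤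
        225 / (8 * k) * (2 * (2 * (k : ℝ) + 1) + s ^ 2) := by gcongr
    have h4 : 225 / (8 * (k : ℝ)) * (2 * (2 * (k : ℝ) + 1) + s ^ 2) < s ^ 2 := by
      rw [div_mul_eq_mul_div, div_lt_iff₀ (by positivity)]
      nlinarith
    linarith
  have hρ := stirlingSeq_two_mul_div_le_one hk0
  have hone : Real.exp E * Real.exp (-E) = 1 := by rw [← Real.exp_add]; simp
  have hM : 0 < Real.sqrt 2 * Real.exp (-(t / 2)) := by positivity
  rw [gaussianMoment_div_pow_eq hk0 ht0, ← hE]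
  calc _ ≤ 1 * Real.exp E * (Real.sqrt 2 * Real.exp (-(t / 2))) *
        (2 * (2 * k + 1) / (2 * (2 * k + 1) + s ^ 2)) := by gcongr
    _ < 1 * Real.exp E * (Real.sqrt 2 * Real.exp (-(t / 2))) * Real.exp (-E) := by gcongr
    _ = _ := by linear_combination (Real.sqrt 2 * Real.exp (-(t / 2))) * hone

/-- Chebyshev's inequality for the polynomial `x ^ (2 k) (x ^ 2 - c) ^ 2`. -/
theorem eventually_omegaTail_lt_of_gaussianMoment_lt (k : ℕ) {A c b : ℝ} (hA : 0 < A)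
    (hc : c < A ^ 2)
    (h : (gaussianMoment (k + 2) - 2 * c * gaussianMoment (k + 1) + c ^ 2 * gaussianMoment k) /
      ((A ^ 2) ^ k * (A ^ 2 - c) ^ 2) < b) :
    ∀ᶠ N in atTop, omegaTail N A < b := by
  have hc' : 0 < A ^ 2 - c := sub_pos.2 hc
  have hD : 0 < (A ^ 2) ^ k * (A ^ 2 - c) ^ 2 := by positivity
  set D := (A ^ 2) ^ k * (A ^ 2 - c) ^ 2
  have hlim := (((tendsto_uniformMean_normalizedOmega_pow (k + 2)).add
    ((tendsto_uniformMean_normalizedOmega_pow (k + 1)).const_mul (-(2 * c)))).add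
    ((tendsto_uniformMean_normalizedOmega_pow k).const_mul (c ^ 2))).const_mul D⁻¹
  have hb : D⁻¹ * (gaussianMoment (k + 2) + -(2 * c) * gaussianMoment (k + 1) +
      c ^ 2 * gaussianMoment k) < b := by
    refine lt_of_eq_of_lt ?_ h
    rw [div_eq_inv_mul]
    ring
  filter_upwards [hlim.eventually_lt_const hb] with N hN
  simp only [← uniformMean_const_mul, ← uniformMean_add] at hN
  refine (omegaTail_le_uniformMean (fun n => ?_) fun n hn => ?_).trans_lt hN
  all_goals
    have e : D⁻¹ * (normalizedOmega N n ^ (2 * (k + 2)) +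
        -(2 * c) * normalizedOmega N n ^ (2 * (k + 1)) + c ^ 2 * normalizedOmega N n ^ (2 * k)) =
        D⁻¹ * ((normalizedOmega N n ^ 2) ^ k * (normalizedOmega N n ^ 2 - c) ^ 2) := by
      rw [← pow_mul]
      ring
    rw [e]
  · positivity
  · have hsq : A ^ 2 ≤ normalizedOmega N n ^ 2 := by
      rw [← sq_abs (normalizedOmega N n)]
      gcongr
    rw [← div_eq_inv_mul, one_le_div hD]
    have : A ^ 2 - c ≤ normalizedOmega N n ^ 2 - c := by linarith
    simp only [D]
    gcongr

theorem eventually_omegaTail_lt_sqrt_two_mul_exp {A : ℝ} (hA : 40 ≤ A) :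
    ∀ᶠ N in atTop, omegaTail N A < Real.sqrt 2 * Real.exp (-(A ^ 2 / 2)) := by
  have ht : 1600 ≤ A ^ 2 := by nlinarith
  set k : ℕ := ⌊(A ^ 2 - 13) / 2⌋₊
  have hk1 : (k : ℝ) ≤ (A ^ 2 - 13) / 2 := Nat.floor_le (by linarith)
  have hk2 : (A ^ 2 - 13) / 2 < k + 1 := Nat.lt_floor_add_one _
  have hk : 200 ≤ k := by
    have : (200 : ℝ) ≤ k := by linarith
    exact_mod_cast this
  set s : ℝ := A ^ 2 - (2 * k + 1) with hs
  have hs0 : 0 < s := by linarith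
  have hlt := gaussianMoment_div_pow_mul_lt (k := k) (s := s) (t := A ^ 2) hk (by linarith)
    (by linarith) (by linarith)
  -- `c = m - 2 m / s` minimises the bound over all `c`
  have hc : 2 * (k : ℝ) + 1 - 2 * (2 * k + 1) / s < A ^ 2 := by
    have : 0 ≤ 2 * (2 * (k : ℝ) + 1) / s := by positivity
    linarith
  refine eventually_omegaTail_lt_of_gaussianMoment_lt k (by linarith) hc (lt_of_eq_of_lt ?_ hlt)
  have hA2 : A ^ 2 - (2 * (k : ℝ) + 1 - 2 * (2 * k + 1) / s) =
      (2 * (2 * k + 1) + s ^ 2) / s := by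
    have : A ^ 2 = s + (2 * k + 1) := by rw [hs]; ring
    rw [this]
    field_simp
    ring
  have hpow : 0 < (A ^ 2) ^ k := by positivity
  rw [hA2, gaussianMoment_succ, gaussianMoment_succ]
  push_cast
  field_simp
  ring

theorem mainTheorem6 :
    -- the tail bound from the `r`-th moment, `r` even
    (∀ r : ℕ, Even r → ∀ ε : ℝ, 0 < ε → ∃ N₀ : ℕ, ∀ N : ℕ, N₀ ≤ N → ∀ A : ℝ, 0 < A →
      omegaTail N A < (1 + ε) * momentBound r A) ∧
    -- the largest even `r < 1 + A ^ 2` gives the best of these bounds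
    (∀ A : ℝ, 0 < A → ∀ r : ℕ, Even r → momentBound (optimalOrder A) A ≤ momentBound r A) ∧
    -- the size of the best bound
    ((fun A : ℝ => momentBound (optimalOrder A) A) ~[atTop]
      fun A : ℝ => Real.sqrt 2 * Real.exp (-(A ^ 2 / 2))) ∧
    -- the resulting tail bound for large `A`
    (∃ A₀ : ℝ, ∀ A : ℝ, A₀ ≤ A → ∃ N₀ : ℕ, ∀ N : ℕ, N₀ ≤ N →
      omegaTail N A ≤ Real.sqrt 2 * Real.exp (-(A ^ 2 / 2))) := by
  refine ⟨fun r hr ε hε => ?_, fun A hA r hr => ?_, isEquivalent_momentBound_optimalOrder,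
    40, fun A hA => ?_⟩
  · obtain ⟨k, rfl⟩ := hr.two_dvd
    exact eventually_omegaTail_lt k hε
  · obtain ⟨k, rfl⟩ := hr.two_dvd
    obtain ⟨K, hK, h1, h2⟩ := exists_optimalOrder_eq_two_mul A
    rw [hK, momentBound_two_mul, momentBound_two_mul]
    exact gaussianMoment_div_pow_le (pow_pos hA 2) h1 h2 k
  · obtain ⟨N₀, h⟩ := eventually_atTop.1 (eventually_omegaTail_lt_sqrt_two_mul_exp hA)
    exact ⟨N₀, fun N hN => (h N hN).le⟩
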